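/- Let $d\ge 1$. A sequence $(\rho_n)_{n\in\mathbb N}$ of functions on $(0,\infty)$ is called a sequence of radial mollifiers (on $\mathbb R^d$) if $\rho_n\in L^1_{\mathrm{loc}}(0,\infty)$, $\rho_n\ge 0$, $\int_0^\infty \rho_n(r)r^{d-1}\,dr=1$ and $\rho_n(r)=0$ for all $r>1$, for every $n$, and $\lim_{n\to\infty}\int_\delta^\infty\rho_n(r)r^{d-1}\,dr=0$ for every $\delta>0$. For $p\ge 1$ and $u\in L^1_{\mathrm{loc}}(\mathbb R^d)$ set $$D_{n,p}(u)(x)=\int_{\mathbb R^d}\frac{|u(x)-u(y)|^p}{|x-y|^p}\,\rho_n(|x-y|)\,dy\in[0,+\infty],\qquad \gamma_{d,p}=\int_{\mathbb S^{d-1}}|\sigma\cdot e|^p\,d\sigma,$$ where $e\in\mathbb S^{d-1}$ is any unit vector and $d\sigma$ is the surface measure (counting measure on $\{-1,1\}$ if $d=1$). Let $\nabla u$ (or $u'$ if $d=1$) denote the weak gradient. 1. If $d=1$, then for every sequence $(\rho_n)$ of radial mollifiers, every $u\in W^{1,1}_{\mathrm{loc}}(\mathbb R)$ and every $p>1$,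 $$\lim_{n\to\infty}D_{n,p}(u)(x)=\gamma_{1,p}|u'(x)|^p\quad\text{for a.e. }x\in\mathbb R.$$ 2. If $d\ge 2$, then for every sequence $(\rho_n)$ of radial mollifiers such that every $\rho_n$ is non-increasing, every $u\in W^{1,1}_{\mathrm{loc}}(\mathbb R^d)$ and every $1\le p\le d/(d-1)$, $$\lim_{n\to\infty}D_{n,p}(u)(x)=\gamma_{d,p}|\nabla u(x)|^p\quad\text{for a.e. }x\in\mathbb R^d.$$ 3. If $d\ge 2$, then for every sequence $(\rho_n)$ of radial mollifiers, every $u\in W^{1,1}_{\mathrm{loc}}(\mathbb R^d)$ and every $p>1$, $$\liminf_{n\to\infty}D_{n,p}(u)(x)\ge\gamma_{d,p}|\nabla u(x)|^p\quad\text{for a.e. }x\in\mathbb R^d.$$ 4. If $d\ge 2$, there exist $u\in W^{1,1}(\mathbb R^d)$ with compact support, a measurable set $A\subset\mathbb R^d$ of positive measure, and a sequence $(\rho_n)$ of radial mollifiers, each $\rho_n$ non-increasing, such that for every $n$ and a.e. $x\in A$, $$D_{n,p}(u)(x)=+\infty\quad\text{for all }p>\frac{d}{d-1}.$$ -/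

import Mathlib

open MeasureTheory Set Filter Topology
open scoped ENNReal ContDiff

/-- A sequence `ρ` of radial mollifiers on `ℝ^d` (only the values on `(0, ∞)` matter):
`ρ n ∈ L¹_loc(0, ∞)`, `ρ n ≥ 0`, `∫_0^∞ ρ n (r) r^(d-1) dr = 1`,
`∫_δ^∞ ρ n (r) r^(d-1) dr → 0` for every `δ > 0`, and `ρ n (r) = 0` for `r > 1`. -/
structure IsRadialMollifier (d : ℕ) (ρ : ℕ → ℝ → ℝ) : Prop where
  locallyIntegrableOn : ∀ n, LocallyIntegrableOn (ρ n) (Ioi 0) volume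
  nonneg : ∀ n, ∀ r, 0 < r → 0 ≤ ρ n r
  integral_eq_one : ∀ n, ∫ r in Ioi (0 : ℝ), ρ n r * r ^ (d - 1) = 1
  tendsto_zero : ∀ δ : ℝ, 0 < δ →
    Tendsto (fun n => ∫ r in Ioi δ, ρ n r * r ^ (d - 1)) atTop (𝓝 0)
  eq_zero : ∀ n, ∀ r, 1 < r → ρ n r = 0

/-- `u ∈ W^{1,1}_loc(E)` with weak gradient `g`: both `u` and `g` are locally integrable and
`∫ u ∂_v φ = - ∫ φ ⟪g, v⟫` for every smooth compactly supported `φ` and every direction `v`.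
On `E = ℝ`, `g` is the weak derivative `u'`. -/
structure HasWeakGradientLoc {E : Type*} [NormedAddCommGroup E] [InnerProductSpace ℝ E]
    [MeasureSpace E] (u : E → ℝ) (g : E → E) : Prop where
  locallyIntegrable : LocallyIntegrable u volume
  locallyIntegrable_grad : LocallyIntegrable g volume
  integral_by_parts : ∀ φ : E → ℝ, ContDiff ℝ ∞ φ → HasCompactSupport φ → ∀ v : E,
    ∫ x, u x * fderiv ℝ φ x v = - ∫ x, φ x * inner ℝ (g x) v

/-- `u ∈ W^{1,1}(E)` with weak gradient `g`. -/
structure HasWeakGradientL1 {E : Type*} [NormedAddCommGroup E] [InnerProductSpace ℝ E]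
    [MeasureSpace E] (u : E → ℝ) (g : E → E) : Prop where
  weakGradient : HasWeakGradientLoc u g
  integrable : Integrable u volume
  integrable_grad : Integrable g volume

/-- `D_p(u)(x) = ∫ |u(x) - u(y)|^p / |x - y|^p ρ(|x - y|) dy ∈ [0, ∞]`, for one profile `ρ`
(the integrand is `0` at the single point `y = x`). -/
noncomputable def nonlocalEnergy {E : Type*} [NormedAddCommGroup E] [MeasureSpace E]
    (ρ : ℝ → ℝ) (p : ℝ) (u : E → ℝ) (x : E) : ℝ≥0∞ :=
  ∫⁻ y, ENNReal.ofReal (|u x - u y| ^ p / ‖x - y‖ ^ p * ρ ‖x - y‖)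

/-- `γ_p = ∫_S |σ · e|^p dσ` over the unit sphere `S` of `E` with its surface measure; for a unit
vector `e` this does not depend on `e`. On `E = ℝ` the surface measure is counting measure on
`{-1, 1}`. -/
noncomputable def sphereMoment {E : Type*} [NormedAddCommGroup E] [InnerProductSpace ℝ E]
    [MeasureSpace E] (p : ℝ) (e : E) : ℝ :=
  ∫ σ : Metric.sphere (0 : E) 1, |inner ℝ (σ : E) e| ^ p ∂(volume : Measure E).toSphere

/-! Fix `x` and write `u (x + h) - u x = ⟪g x, h⟫ + v h`. In polar coordinates the linear part has
energy exactly `γ |g x| ^ p`, because `|⟪g x, h⟫| / |h|` does not depend on the radius and the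
mollifiers have mass one (`radialEnergy_inner`). Everything then depends on how small the remainder
`v` is at almost every `x`.

At a Lebesgue point of `g`, `∫_{B(x,t)} |g - g x| ≤ K t ^ d` with `K` arbitrarily small for small
`t`. Smoothing by bumps keeps this growth at all scales up to a factor `4 ^ d`
(`lintegral_mollify_sub_le`), so estimates for `C¹` functions pass to `v` by Fatou. Integrating
along rays bounds the integral of `|v|` over the unit directions at radius `r` by `C K r`; hence the
`p = 1` energy of `v` tends to zero for all radial mollifiers.

In dimension one the sphere is two atoms, so that bound is pointwise and handles every `p`;
Minkowski's inequality gives (1). For (2), the Gagliardo-Nirenberg-Sobolev inequality gives `∫_{B_r}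
|v| ^ p ≤ C K ^ p r ^ (d + p)` up to `p = d / (d - 1)`, and a layer-cake argument turns this into a
bound against the decreasing weights `ρ r * r ^ (-p)`. For (3), convexity of `t ^ p` bounds the
energy from below by that of the linear part minus a multiple of the `p = 1` energy of `v`
(`radialEnergy_inner_le`).

For (4), `u` behaves like `|y| ^ (1 - d) / log² |y|` at the origin. The logarithm makes the gradient
integrable, but `|u| ^ p` is not integrable near the origin when `p > d / (d - 1)`. Mollifiers
bounded below on `(0, 1]` detect this from every point of a ball
(`nonlocalEnergy_logProfile_eq_top`). -/

/-! ### Polar coordinates for Haar measures. -/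

section Polar

variable {E : Type*} [NormedAddCommGroup E] [NormedSpace ℝ E] [FiniteDimensional ℝ E]
  [MeasurableSpace E] [BorelSpace E]

/-- The measure `r ^ n dr` on `(0, ∞)`, as a measure on `ℝ`. -/
noncomputable def radialPow (n : ℕ) : Measure ℝ :=
  (volume.restrict (Ioi 0)).withDensity fun r => ENNReal.ofReal (r ^ n)

lemma measurePreserving_val_volumeIoiPow (n : ℕ) :
    MeasurePreserving (Subtype.val : Ioi (0 : ℝ) → ℝ) (Measure.volumeIoiPow n) (radialPow n) := by
  refine ⟨measurable_subtype_coe, ?_⟩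
  ext s hs
  rw [Measure.map_apply measurable_subtype_coe hs, radialPow, Measure.volumeIoiPow,
    withDensity_apply _ (measurable_subtype_coe hs), withDensity_apply _ hs,
    ← map_comap_subtype_coe measurableSet_Ioi, setLIntegral_map hs (by fun_prop)
      measurable_subtype_coe]

instance (n : ℕ) : SFinite (radialPow n) := by
  unfold radialPow; infer_instance

/-- The radial measure is carried by `(0, ∞)` and the origin is a null set, so polar coordinates can
be stated on all of `ℝ` and `E`, without subtypes. -/
lemma measurePreserving_polar [Nontrivial E] (μ : Measure E) [μ.IsAddHaarMeasure] :
    MeasurePreserving (fun z : Metric.sphere (0 : E) 1 × ℝ => z.2 • (z.1 : E))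
      (μ.toSphere.prod (radialPow (Module.finrank ℝ E - 1))) μ := by
  have hmeas : Measurable (fun z : Metric.sphere (0 : E) 1 × ℝ => z.2 • (z.1 : E)) := by
    fun_prop
  refine ⟨hmeas, ?_⟩
  have h1 : MeasurePreserving (Prod.map id Subtype.val :
      Metric.sphere (0 : E) 1 × Ioi (0 : ℝ) → Metric.sphere (0 : E) 1 × ℝ)
      (μ.toSphere.prod (Measure.volumeIoiPow (Module.finrank ℝ E - 1)))
      (μ.toSphere.prod (radialPow (Module.finrank ℝ E - 1))) :=
    (MeasurePreserving.id _).prod (measurePreserving_val_volumeIoiPow _)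
  have h2 := (μ.measurePreserving_homeomorphUnitSphereProd).symm
    (homeomorphUnitSphereProd E).toMeasurableEquiv
  have h3 : Measure.map (Subtype.val : ({0}ᶜ : Set E) → E) (μ.comap Subtype.val) = μ := by
    rw [map_comap_subtype_coe (measurableSet_singleton _).compl, restrict_compl_singleton]
  rw [← h1.map_eq, Measure.map_map hmeas h1.measurable]
  conv_rhs => rw [← h3, ← h2.map_eq, Measure.map_map measurable_subtype_coe h2.measurable]
  rfl

lemma ae_radialPow_iff {n : ℕ} {P : ℝ → Prop} :
    (∀ᵐ r ∂radialPow n, P r) ↔ ∀ᵐ r ∂volume.restrict (Ioi (0 : ℝ)), P r := by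
  rw [radialPow, ae_withDensity_iff (by fun_prop)]
  refine eventually_congr ?_
  filter_upwards [ae_restrict_mem measurableSet_Ioi] with r hr
  have : ENNReal.ofReal (r ^ n) ≠ 0 := by
    have : 0 < r ^ n := pow_pos hr n
    simpa using this
  simp [this]

/-- Fubini in polar coordinates. It transfers almost everywhere convergence of mollifications to
almost every sphere. -/
lemma ae_polar [Nontrivial E] (μ : Measure E) [μ.IsAddHaarMeasure] {P : E → Prop}
    (h : ∀ᵐ y ∂μ, P y) :
    ∀ᵐ r ∂volume.restrict (Ioi (0 : ℝ)),
      ∀ᵐ σ : Metric.sphere (0 : E) 1 ∂μ.toSphere, P (r • (σ : E)) := by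
  have h1 := (measurePreserving_polar μ).quasiMeasurePreserving.ae h
  have h2 := (Measure.measurePreserving_swap
    (μ := radialPow (Module.finrank ℝ E - 1)) (ν := μ.toSphere)).quasiMeasurePreserving.ae h1
  exact ae_radialPow_iff.1 (Measure.ae_ae_of_ae_prod h2)

lemma lintegral_radialPow (n : ℕ) (f : ℝ → ℝ≥0∞) :
    ∫⁻ r, f r ∂radialPow n = ∫⁻ r in Ioi (0 : ℝ), ENNReal.ofReal (r ^ n) * f r := by
  rw [radialPow, lintegral_withDensity_eq_lintegral_mul_non_measurable _ (by fun_prop)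
    (by simp)]
  rfl

lemma lintegral_polar [Nontrivial E] (μ : Measure E) [μ.IsAddHaarMeasure] {f : E → ℝ≥0∞}
    (hf : AEMeasurable f μ) :
    ∫⁻ y, f y ∂μ = ∫⁻ r in Ioi (0 : ℝ), ENNReal.ofReal (r ^ (Module.finrank ℝ E - 1)) *
      ∫⁻ σ, f (r • (σ : E)) ∂μ.toSphere := by
  have hp := measurePreserving_polar μ
  rw [← lintegral_radialPow]
  conv_lhs => rw [← hp.map_eq, lintegral_map' (by rwa [hp.map_eq]) hp.aemeasurable]
  exact lintegral_prod_symm _ (hf.comp_quasiMeasurePreserving hp.quasiMeasurePreserving)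

/-- The norm is quasi-measure-preserving from a Haar measure to Lebesgue measure on `(0, ∞)`. -/
lemma quasiMeasurePreserving_norm [Nontrivial E] (μ : Measure E) [μ.IsAddHaarMeasure] :
    Measure.QuasiMeasurePreserving (fun y : E => ‖y‖) μ (volume.restrict (Ioi 0)) := by
  refine ⟨measurable_norm, Measure.AbsolutelyContinuous.mk fun s hs h => ?_⟩
  rw [Measure.map_apply measurable_norm hs, ← lintegral_indicator_one (measurable_norm hs),
    lintegral_polar μ ((measurable_one.indicator (measurable_norm hs)).aemeasurable)]
  have h0 : ∀ᵐ r ∂volume.restrict (Ioi (0 : ℝ)), r ∉ s := measure_eq_zero_iff_ae_notMem.1 h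
  rw [← lintegral_zero (μ := volume.restrict (Ioi (0 : ℝ)))]
  refine lintegral_congr_ae ?_
  filter_upwards [h0, ae_restrict_mem measurableSet_Ioi] with r hr hr0
  have : ∀ σ : Metric.sphere (0 : E) 1, r • (σ : E) ∉ (fun y : E => ‖y‖) ⁻¹' s := by
    intro σ
    simpa [norm_smul, abs_of_pos (mem_Ioi.1 hr0)] using hr
  simp [indicator_of_notMem (this _)]

lemma lintegral_norm_mul_polar [Nontrivial E] (μ : Measure E) [μ.IsAddHaarMeasure]
    {w : ℝ → ℝ≥0∞} {f : E → ℝ≥0∞} (hw : AEMeasurable w (volume.restrict (Ioi 0)))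
    (hw' : ∀ r, w r ≠ ⊤) (hf : AEMeasurable f μ) :
    ∫⁻ y, w ‖y‖ * f y ∂μ = ∫⁻ r in Ioi (0 : ℝ), w r *
      (ENNReal.ofReal (r ^ (Module.finrank ℝ E - 1)) *
      ∫⁻ σ, f (r • (σ : E)) ∂μ.toSphere) := by
  have hm : AEMeasurable (fun y => w ‖y‖ * f y) μ :=
    (hw.comp_quasiMeasurePreserving (quasiMeasurePreserving_norm μ)).mul hf
  rw [lintegral_polar μ hm]
  refine setLIntegral_congr_fun measurableSet_Ioi fun r hr => ?_
  have hn : ∀ σ : Metric.sphere (0 : E) 1, ‖r • (σ : E)‖ = r := fun σ => by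
    simp [norm_smul, abs_of_pos (mem_Ioi.1 hr)]
  simp only [hn]
  rw [lintegral_const_mul' _ _ (hw' r), mul_left_comm]

/-- Integrals over closed balls in polar coordinates. -/
lemma setLIntegral_closedBall_polar [Nontrivial E] (μ : Measure E) [μ.IsAddHaarMeasure]
    {f : E → ℝ≥0∞} (hf : AEMeasurable f μ) (s : ℝ) :
    ∫⁻ y in Metric.closedBall 0 s, f y ∂μ = ∫⁻ r in Ioc (0 : ℝ) s,
      ENNReal.ofReal (r ^ (Module.finrank ℝ E - 1)) *
      ∫⁻ σ, f (r • (σ : E)) ∂μ.toSphere := by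
  have h := lintegral_norm_mul_polar μ (w := (Iic s).indicator 1) (f := f)
    ((measurable_one.indicator measurableSet_Iic).aemeasurable)
    (fun r => by by_cases hr : r ∈ Iic s <;> simp [hr]) hf
  rw [← lintegral_indicator Metric.isClosed_closedBall.measurableSet]
  convert h using 1
  · refine lintegral_congr fun y => ?_
    by_cases hy : ‖y‖ ≤ s <;> simp [indicator, hy]
  · rw [← Ioi_inter_Iic, inter_comm, ← Measure.restrict_restrict measurableSet_Iic,
      ← lintegral_indicator measurableSet_Iic]
    refine lintegral_congr fun r => ?_
    by_cases hy : r ≤ s <;> simp [indicator, hy]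

end Polar

/-! ### Comparison of measures tested on decreasing functions. -/

section LayerCake

/-- If two measures on `(0, ∞)` are ordered on all intervals `(0, s]`, then so are the integrals of
antitone functions. -/
lemma lintegral_antitoneOn_le {μ ν : Measure ℝ}
    (h : ∀ s, 0 < s → μ (Ioc 0 s) ≤ ν (Ioc 0 s)) {w : ℝ → ℝ} (hw : AntitoneOn w (Ioi 0))
    (hw0 : ∀ r, 0 < r → 0 ≤ w r) :
    ∫⁻ r in Ioi (0 : ℝ), ENNReal.ofReal (w r) ∂μ ≤
      ∫⁻ r in Ioi (0 : ℝ), ENNReal.ofReal (w r) ∂ν := by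
  have hm : ∀ κ : Measure ℝ, AEMeasurable w (κ.restrict (Ioi 0)) := fun κ =>
    aemeasurable_restrict_of_antitoneOn measurableSet_Ioi hw
  have hn : ∀ κ : Measure ℝ, 0 ≤ᵐ[κ.restrict (Ioi 0)] w := fun κ => by
    filter_upwards [ae_restrict_mem measurableSet_Ioi] with r hr using hw0 r hr
  rw [lintegral_eq_lintegral_meas_lt _ (hn μ) (hm μ), lintegral_eq_lintegral_meas_lt _ (hn ν) (hm ν)]
  refine lintegral_mono fun t => ?_
  rw [Measure.restrict_apply' measurableSet_Ioi, Measure.restrict_apply' measurableSet_Ioi]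
  -- A superlevel set of an antitone function is an initial segment of `(0, ∞)`: it is empty, or
  -- `(0, m]`, or has no largest element.
  set I : Set ℝ := {a | t < w a} ∩ Ioi 0 with hI
  have hIl : ∀ a ∈ I, Ioc 0 a ⊆ I := fun a ha b hb =>
    ⟨lt_of_lt_of_le ha.1 (hw hb.1 ha.2 hb.2), hb.1⟩
  rcases I.eq_empty_or_nonempty with he | hne
  · simp [he]
  by_cases hmax : ∃ m ∈ I, ∀ a ∈ I, a ≤ m
  · obtain ⟨m, hm, hmax⟩ := hmax
    have : I = Ioc 0 m := Subset.antisymm (fun a ha => ⟨ha.2, hmax a ha⟩) (hIl m hm)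
    rw [this]
    exact h _ hm.2
  · push Not at hmax
    -- Without a maximum, `I` is a countable directed union of intervals `(0, q]`, and both measures
    -- are suprema over it.
    have hU : I = ⋃ q ∈ {q : ℚ | (q : ℝ) ∈ I}, Ioc 0 (q : ℝ) := by
      refine Subset.antisymm (fun a ha => ?_) (iUnion₂_subset fun q hq => hIl _ hq)
      obtain ⟨b, hb, hab⟩ := hmax a ha
      obtain ⟨q, haq, hqb⟩ := exists_rat_btwn hab
      exact mem_iUnion₂.2 ⟨q, hIl b hb ⟨lt_trans ha.2 haq, hqb.le⟩, ha.2, haq.le⟩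
    rw [hU, measure_biUnion_eq_iSup (to_countable _), measure_biUnion_eq_iSup (to_countable _)]
    · exact iSup₂_mono fun q hq => h _ hq.2
    all_goals
      intro p hp q hq
      rcases le_total p q with hpq | hpq
      · exact ⟨q, hq, Ioc_subset_Ioc_right (by exact_mod_cast hpq), subset_rfl⟩
      · exact ⟨p, hp, subset_rfl, Ioc_subset_Ioc_right (by exact_mod_cast hpq)⟩

end LayerCake

/-! ### Mollification of weakly differentiable functions. -/

section Mollify

open Metric ContinuousLinearMap Module
open scoped Convolution

variable {E : Type*} [NormedAddCommGroup E] [InnerProductSpace ℝ E] [FiniteDimensional ℝ E]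
  [MeasureSpace E] [BorelSpace E] [(volume : Measure E).IsAddHaarMeasure]
  {F : Type*} [NormedAddCommGroup F] [NormedSpace ℝ F]

/-- Convolution with a normalized smooth bump function. -/
noncomputable def mollify (φ : ContDiffBump (0 : E)) (g : E → F) : E → F :=
  φ.normed volume ⋆[lsmul ℝ ℝ, volume] g

lemma mollify_apply (φ : ContDiffBump (0 : E)) (g : E → F) (y : E) :
    mollify φ g y = ∫ z, φ.normed volume (y - z) • g z := by
  simp [mollify, convolution_eq_swap]

lemma integrable_normed_sub_smul (φ : ContDiffBump (0 : E)) {g : E → F}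
    (hg : LocallyIntegrable g volume) (y : E) :
    Integrable (fun z => φ.normed volume (y - z) • g z) := by
  refine hg.integrable_smul_left_of_hasCompactSupport
    (φ.continuous_normed.comp (continuous_const.sub continuous_id)) ?_
  exact φ.hasCompactSupport_normed.comp_homeomorph (Homeomorph.subLeft y)

lemma contDiff_mollify (φ : ContDiffBump (0 : E)) {g : E → F}
    (hg : LocallyIntegrable g volume) : ContDiff ℝ ∞ (mollify φ g) :=
  φ.hasCompactSupport_normed.contDiff_convolution_left _ φ.contDiff_normed hg

lemma fderiv_mollify_apply (φ : ContDiffBump (0 : E)) {u : E → ℝ}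
    (hu : LocallyIntegrable u volume) (x v : E) :
    fderiv ℝ (mollify φ u) x v =
      ∫ z, fderiv ℝ (φ.normed (volume : Measure E)) (x - z) v * u z := by
  have hd : ContDiff ℝ ∞ (φ.normed (volume : Measure E)) := φ.contDiff_normed
  have hex := HasCompactSupport.convolutionExists_left
    (precompL E (lsmul ℝ ℝ : ℝ →L[ℝ] ℝ →L[ℝ] ℝ)) (φ.hasCompactSupport_normed.fderiv ℝ)
    (hd.continuous_fderiv (by simp)) hu x
  have h1 := φ.hasCompactSupport_normed.hasFDerivAt_convolution_left
    (lsmul ℝ ℝ : ℝ →L[ℝ] ℝ →L[ℝ] ℝ) (hd.of_le (by simp)) hu x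
  unfold mollify
  rw [h1.fderiv, convolution_eq_swap, ContinuousLinearMap.integral_apply hex.integrable_swap]
  rfl

/-- Testing the weak gradient identity with `z ↦ φ (x - z)` moves the derivative from the kernel to
`u`; the two minus signs cancel. -/
lemma HasWeakGradientLoc.fderiv_mollify {u : E → ℝ} {g : E → E}
    (h : HasWeakGradientLoc u g) (φ : ContDiffBump (0 : E)) (x v : E) :
    fderiv ℝ (mollify φ u) x v = inner ℝ (mollify φ g x) v := by
  have hd : ContDiff ℝ ∞ (φ.normed (volume : Measure E)) := φ.contDiff_normed
  have h2 := h.integral_by_parts (fun z => φ.normed volume (x - z))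
    (hd.comp (contDiff_const.sub contDiff_id))
    (φ.hasCompactSupport_normed.comp_homeomorph (Homeomorph.subLeft x)) v
  have h3 : ∀ z, fderiv ℝ (fun z => φ.normed (volume : Measure E) (x - z)) z v =
      - fderiv ℝ (φ.normed (volume : Measure E)) (x - z) v := by
    intro z
    have := ((hd.differentiable (by simp) (x - z)).hasFDerivAt).comp z
      ((hasFDerivAt_id z).const_sub x)
    rw [show (fun z => φ.normed (volume : Measure E) (x - z)) =
      φ.normed (volume : Measure E) ∘ HSub.hSub x from rfl, this.fderiv]
    simp
  simp only [h3, mul_neg, integral_neg, neg_inj] at h2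
  rw [fderiv_mollify_apply φ h.locallyIntegrable, mollify_apply, real_inner_comm,
    ← integral_inner (integrable_normed_sub_smul φ h.locallyIntegrable_grad x)]
  simp only [mul_comm (u _)] at h2
  rw [h2]
  simp only [inner_smul_right, real_inner_comm]

lemma enorm_mollify_sub_le [CompleteSpace F] (φ : ContDiffBump (0 : E)) {g : E → F}
    (hg : LocallyIntegrable g volume) (y : E) (c : F) :
    ‖mollify φ g y - c‖ₑ ≤ ∫⁻ z, ENNReal.ofReal (φ.normed volume (y - z)) * ‖g z - c‖ₑ := by
  have h1 : ∫ z, φ.normed volume (y - z) • c = c := by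
    rw [integral_smul_const, integral_sub_left_eq_self (φ.normed volume) volume y,
      φ.integral_normed, one_smul]
  rw [mollify_apply]
  nth_rw 1 [← h1]
  rw [← integral_sub (integrable_normed_sub_smul φ hg y)
    (integrable_normed_sub_smul φ (locallyIntegrable_const c) y)]
  refine (enorm_integral_le_lintegral_enorm _).trans (lintegral_mono fun z => ?_)
  rw [← smul_sub, enorm_smul, Real.enorm_of_nonneg (φ.nonneg_normed _)]

/-- The growth bound survives mollification with a constant independent of the bump radius `ε`. This
uniformity is what permits the later passage to the limit. -/
lemma lintegral_mollify_sub_le [CompleteSpace F] {g : E → F} (hg : LocallyIntegrable g volume) {x : E} {c : F}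
    {K : ℝ≥0∞} {R : ℝ} (hK : ∀ t, 0 < t → t ≤ 2 * R →
      ∫⁻ y in closedBall x t, ‖g y - c‖ₑ ≤ K * ENNReal.ofReal (t ^ finrank ℝ E))
    (φ : ContDiffBump (0 : E)) (hφ : φ.rOut = 2 * φ.rIn) (hφR : φ.rOut ≤ R) {s : ℝ}
    (hs : 0 < s) (hsR : s ≤ R) :
    ∫⁻ y in closedBall x s, ‖mollify φ g y - c‖ₑ ≤
      4 ^ finrank ℝ E * K * ENNReal.ofReal (s ^ finrank ℝ E) := by
  have hε := φ.rOut_pos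
  set ε := φ.rOut with hε'
  set d := finrank ℝ E
  have hφm : Measurable (φ.normed (volume : Measure E)) := φ.continuous_normed.measurable
  have hNm : AEMeasurable (fun z => ‖g z - c‖ₑ) volume :=
    (hg.aestronglyMeasurable.sub aestronglyMeasurable_const).enorm
  have hz : ∀ y z, ε < dist y z → φ.normed (volume : Measure E) (y - z) = 0 := by
    intro y z hyz
    have : y - z ∉ Function.support (φ.normed (volume : Measure E)) := by
      rw [φ.support_normed_eq]
      simpa [← dist_eq_norm] using hyz.le
    simpa using this
  have h42 : (4 : ℝ≥0∞) ^ d = 2 ^ d * 2 ^ d := by rw [← mul_pow]; norm_num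
  rcases le_or_gt ε s with hεs | hεs
  -- For `ε ≤ s`, Fubini and the unit mass of the kernel reduce to the integral over the ball of
  -- radius `2 s`, at the cost of `2 ^ d`.
  · calc ∫⁻ y in closedBall x s, ‖mollify φ g y - c‖ₑ
        ≤ ∫⁻ y in closedBall x s, ∫⁻ z,
            ENNReal.ofReal (φ.normed volume (y - z)) * ‖g z - c‖ₑ :=
          lintegral_mono fun y => enorm_mollify_sub_le φ hg y c
      _ = ∫⁻ z, ∫⁻ y in closedBall x s,
            ENNReal.ofReal (φ.normed volume (y - z)) * ‖g z - c‖ₑ := by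
          refine lintegral_lintegral_swap ?_
          exact (by fun_prop : Measurable fun p : E × E =>
            ENNReal.ofReal (φ.normed volume (p.1 - p.2))).aemeasurable.mul hNm.comp_snd
      _ ≤ ∫⁻ z, (closedBall x (2 * s)).indicator (fun z => ‖g z - c‖ₑ) z := by
          refine lintegral_mono fun z => ?_
          rw [lintegral_mul_const'' _ (by fun_prop)]
          by_cases hzx : z ∈ closedBall x (2 * s)
          · rw [indicator_of_mem hzx]
            refine mul_le_of_le_one_left (zero_le) ?_
            refine (setLIntegral_le_lintegral _ _).trans ?_
            rw [lintegral_sub_right_eq_self (fun y => ENNReal.ofReal (φ.normed volume y)) z,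
              ← ofReal_integral_eq_lintegral_ofReal φ.integrable_normed
                (ae_of_all _ φ.nonneg_normed), φ.integral_normed, ENNReal.ofReal_one]
          · rw [setLIntegral_congr_fun (g := fun _ => 0) measurableSet_closedBall]
            · simp
            · intro y hy
              beta_reduce
              rw [hz, ENNReal.ofReal_zero]
              rw [mem_closedBall] at hy hzx
              have := dist_triangle_left z x y
              linarith
      _ = ∫⁻ z in closedBall x (2 * s), ‖g z - c‖ₑ :=
          lintegral_indicator measurableSet_closedBall _
      _ ≤ K * ENNReal.ofReal ((2 * s) ^ d) := hK _ (by linarith) (by linarith)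
      _ = 2 ^ d * K * ENNReal.ofReal (s ^ d) := by
          rw [mul_pow, ENNReal.ofReal_mul (by positivity), ENNReal.ofReal_pow (by norm_num)]
          simp; ring
      _ ≤ _ := by gcongr; norm_num
  -- For `s < ε`, the kernel is at most `2 ^ d / |B_ε|` and only the ball of radius `2 ε` is seen.
  -- This yields a pointwise bound of order `K`, and the two factors `2 ^ d` make `4 ^ d`.
  · have hpt : ∀ y ∈ closedBall x s, ‖mollify φ g y - c‖ₑ ≤
        ENNReal.ofReal (2 ^ d / volume.real (closedBall (0 : E) ε)) *
          (K * ENNReal.ofReal ((2 * ε) ^ d)) := by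
      intro y hy
      refine (enorm_mollify_sub_le φ hg y c).trans ?_
      calc _ ≤ ∫⁻ z in closedBall x (2 * ε),
            ENNReal.ofReal (2 ^ d / volume.real (closedBall (0 : E) ε)) * ‖g z - c‖ₑ := by
            rw [← lintegral_indicator measurableSet_closedBall]
            refine lintegral_mono fun z => ?_
            by_cases hzx : z ∈ closedBall x (2 * ε)
            · rw [indicator_of_mem hzx]
              gcongr
              exact φ.normed_le_div_measure_closedBall_rOut volume 2 hφ.le _
            · rw [hz]
              · simp
              rw [mem_closedBall] at hy hzx
              have := dist_triangle_left z x y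
              linarith
        _ ≤ _ := by
            rw [lintegral_const_mul' _ _ ENNReal.ofReal_ne_top]
            gcongr
            exact hK _ (by linarith) (by linarith)
    refine (setLIntegral_mono' measurableSet_closedBall hpt).trans ?_
    rw [setLIntegral_const, Measure.addHaar_closedBall _ _ hs.le,
      Measure.addHaar_real_closedBall _ _ hε.le, h42]
    have hb : 0 < volume.real (ball (0 : E) 1) :=
      ENNReal.toReal_pos (measure_ball_pos _ _ one_pos).ne' measure_ball_lt_top.ne
    rw [← ENNReal.ofReal_toReal (measure_ball_lt_top (μ := (volume : Measure E)) (x := 0) (r := 1)).ne]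
    change _ * (_ * ENNReal.ofReal (volume.real (ball (0 : E) 1))) ≤ _
    have : ENNReal.ofReal (2 ^ d / (ε ^ d * volume.real (ball (0 : E) 1))) *
        (K * ENNReal.ofReal ((2 * ε) ^ d)) * (ENNReal.ofReal (s ^ d) * ENNReal.ofReal (volume.real (ball (0 : E) 1))) = K * ENNReal.ofReal (2 ^ d * 2 ^ d * s ^ d) := by
      rw [show (2 : ℝ) ^ d * 2 ^ d * s ^ d = 2 ^ d / (ε ^ d * volume.real (ball (0 : E) 1)) * ((2 * ε) ^ d) * (s ^ d * volume.real (ball (0 : E) 1)) by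
        rw [mul_pow]; field_simp]
      rw [ENNReal.ofReal_mul (by positivity), ENNReal.ofReal_mul (by positivity), ENNReal.ofReal_mul (by positivity)]
      ring
    rw [this, ENNReal.ofReal_mul (by positivity), ENNReal.ofReal_mul (by positivity), ENNReal.ofReal_pow (by norm_num)]
    simp
    ring_nf
    rfl

end Mollify

/-! ### From growth of the gradient on balls to spherical means. -/

section LayerCakeBall

open Metric Module

variable {E : Type*} [NormedAddCommGroup E] [NormedSpace ℝ E] [FiniteDimensional ℝ E]
  [MeasurableSpace E] [BorelSpace E] [Nontrivial E]

lemma setLIntegral_Ioc_rpow_sub_one {a s : ℝ} (ha : 0 < a) (hs : 0 ≤ s) :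
    ∫⁻ r in Ioc 0 s, ENNReal.ofReal (a * r ^ (a - 1)) = ENNReal.ofReal (s ^ a) := by
  have hi : IntervalIntegrable (fun r : ℝ => a * r ^ (a - 1)) volume 0 s :=
    (intervalIntegral.intervalIntegrable_rpow' (by linarith)).const_mul a
  rw [← ofReal_integral_eq_lintegral_ofReal ((intervalIntegrable_iff_integrableOn_Ioc_of_le hs).1 hi),
    ← intervalIntegral.integral_of_le hs, intervalIntegral.integral_const_mul,
    integral_rpow (Or.inl (by linarith))]
  · congr 1
    rw [sub_add_cancel, Real.zero_rpow ha.ne']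
    field_simp
    simp
  · filter_upwards [ae_restrict_mem measurableSet_Ioc] with r hr
    exact mul_nonneg ha.le (Real.rpow_nonneg hr.1.le _)

/-- A growth bound `∫_{B_s} f ≤ K s ^ a` controls the integrals of `f` against antitone radial
weights. -/
lemma setLIntegral_closedBall_antitoneOn_mul_le (μ : Measure E) [μ.IsAddHaarMeasure]
    {f : E → ℝ≥0∞} (hf : AEMeasurable f μ) {K : ℝ≥0∞} {a R : ℝ} (ha : 0 < a)
    (hK : ∀ s, 0 < s → s ≤ R → ∫⁻ y in closedBall 0 s, f y ∂μ ≤ K * ENNReal.ofReal (s ^ a))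
    {w : ℝ → ℝ} (hw : AntitoneOn w (Ioi 0)) (hw0 : ∀ r, 0 < r → 0 ≤ w r) :
    ∫⁻ y in closedBall 0 R, ENNReal.ofReal (w ‖y‖) * f y ∂μ ≤
      K * ∫⁻ r in Ioc 0 R, ENNReal.ofReal (a * r ^ (a - 1)) * ENNReal.ofReal (w r) := by
  rcases le_or_gt R 0 with hR | hR
  · have : μ (closedBall 0 R) = 0 := by
      refine measure_mono_null (closedBall_subset_closedBall hR) ?_
      simp
    rw [Measure.restrict_eq_zero.2 this]
    simp
  set κ : Measure ℝ := ((μ.restrict (closedBall 0 R)).withDensity f).map norm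
  set ν : Measure ℝ := K • (volume.restrict (Ioc 0 R)).withDensity
    fun r => ENNReal.ofReal (a * r ^ (a - 1))
  -- The growth hypothesis says precisely that `κ`, the radial image of `f dμ`, is dominated by `ν`
  -- on every `(0, s]`; the value `min s R` accounts for the truncation at `R`.
  have hκν : ∀ s, 0 < s → κ (Ioc 0 s) ≤ ν (Ioc 0 s) := by
    intro s hs
    have hm : MeasurableSet ((norm : E → ℝ) ⁻¹' Ioc 0 s) := measurable_norm measurableSet_Ioc
    rw [Measure.map_apply measurable_norm measurableSet_Ioc, withDensity_apply _ hm,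
      Measure.restrict_restrict hm, Measure.smul_apply, withDensity_apply _ measurableSet_Ioc,
      Measure.restrict_restrict measurableSet_Ioc, Ioc_inter_Ioc, sup_idem,
      setLIntegral_Ioc_rpow_sub_one ha (le_min hs.le hR.le)]
    refine le_trans (lintegral_mono_set ?_) (hK (min s R) (lt_min hs hR) (min_le_right _ _))
    intro y hy
    have h1 := hy.2
    have h2 := hy.1.2
    simp only [mem_closedBall, dist_zero_right] at h1 ⊢
    exact le_min h2 h1
  have hwm : AEMeasurable w (volume.restrict (Ioi 0)) :=
    aemeasurable_restrict_of_antitoneOn measurableSet_Ioi hw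
  have main := lintegral_antitoneOn_le hκν hw hw0
  have hκ : ∫⁻ r in Ioi (0 : ℝ), ENNReal.ofReal (w r) ∂κ =
      ∫⁻ y in closedBall 0 R, ENNReal.ofReal (w ‖y‖) * f y ∂μ := by
    have hS : MeasurableSet ((norm : E → ℝ) ⁻¹' Ioi 0) := measurable_norm measurableSet_Ioi
    have hwκ : AEMeasurable w (κ.restrict (Ioi 0)) :=
      aemeasurable_restrict_of_antitoneOn measurableSet_Ioi hw
    have hnull : ((μ.restrict (closedBall 0 R)).withDensity f).restrict
        ((norm : E → ℝ) ⁻¹' Ioi 0) = (μ.restrict (closedBall 0 R)).withDensity f := by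
      refine Measure.restrict_eq_self_of_ae_mem ?_
      refine (withDensity_absolutelyContinuous _ _).ae_le ?_
      refine ae_restrict_of_ae ?_
      filter_upwards [measure_eq_zero_iff_ae_notMem.1 (measure_singleton (μ := μ) (0 : E))] with y hy
      simpa using hy
    rw [Measure.restrict_map measurable_norm measurableSet_Ioi] at hwκ ⊢
    rw [lintegral_map' hwκ.ennreal_ofReal measurable_norm.aemeasurable, hnull,
      lintegral_withDensity_eq_lintegral_mul₀ hf.restrict]
    · simp only [Pi.mul_apply, mul_comm]
    · exact (hwm.ennreal_ofReal.comp_quasiMeasurePreserving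
        (quasiMeasurePreserving_norm μ)).restrict
  have hν : ∫⁻ r in Ioi (0 : ℝ), ENNReal.ofReal (w r) ∂ν =
      K * ∫⁻ r in Ioc 0 R, ENNReal.ofReal (a * r ^ (a - 1)) * ENNReal.ofReal (w r) := by
    rw [Measure.restrict_smul, lintegral_smul_measure, smul_eq_mul,
      restrict_withDensity measurableSet_Ioi, Measure.restrict_restrict measurableSet_Ioi,
      inter_eq_right.2 Ioc_subset_Ioi_self,
      lintegral_withDensity_eq_lintegral_mul_non_measurable₀ _ (by fun_prop) (by simp)]
    rfl
  rwa [hκ, hν] at main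

/-- The growth of the gradient controls spherical means of a `C¹` function vanishing at `0`. -/
lemma lintegral_sphere_enorm_le_of_fderiv (μ : Measure E) [μ.IsAddHaarMeasure] {w : E → ℝ}
    (hw : ContDiff ℝ 1 w) (hw0 : w 0 = 0) {K : ℝ≥0∞} {r : ℝ} (hr : 0 < r)
    (hK : ∀ s, 0 < s → s ≤ r →
      ∫⁻ y in closedBall 0 s, ‖fderiv ℝ w y‖ₑ ∂μ ≤ K * ENNReal.ofReal (s ^ finrank ℝ E)) :
    ∫⁻ σ, ‖w (r • (σ : E))‖ₑ ∂μ.toSphere ≤ finrank ℝ E * K * ENNReal.ofReal r := by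
  set d := finrank ℝ E with hd
  have hd0 : 0 < d := finrank_pos
  have hc : Continuous fun y => ‖fderiv ℝ w y‖ₑ := (hw.continuous_fderiv (by simp)).enorm
  -- Integrate the derivative along the ray from the origin, where `w` vanishes.
  have hpt : ∀ σ : sphere (0 : E) 1, ‖w (r • (σ : E))‖ₑ ≤
      ∫⁻ s in Ioc 0 r, ‖fderiv ℝ w (s • (σ : E))‖ₑ := by
    intro σ
    have h1 : ContDiff ℝ 1 fun s : ℝ => w (s • (σ : E)) :=
      hw.comp (contDiff_id.smul contDiff_const)
    have h2 := enorm_sub_le_lintegral_deriv_of_contDiffOn_Icc h1.contDiffOn hr.le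
    simp only [zero_smul, hw0, sub_zero] at h2
    rw [restrict_Ioc_eq_restrict_Icc]
    refine h2.trans (lintegral_mono fun s => ?_)
    have h3 : HasDerivAt (fun s : ℝ => w (s • (σ : E))) (fderiv ℝ w (s • (σ : E)) σ) s := by
      have h4 : HasDerivAt (fun s : ℝ => s • (σ : E)) (σ : E) s := by
        simpa using (hasDerivAt_id s).smul_const (σ : E)
      exact (hw.differentiable (by simp) (s • (σ : E))).hasFDerivAt.comp_hasDerivAt s h4
    rw [h3.deriv]
    simp only [enorm_eq_nnnorm, ENNReal.coe_le_coe]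
    refine ((fderiv ℝ w (s • (σ : E))).le_opNNNorm σ).trans ?_
    have : ‖(σ : E)‖₊ = 1 := by ext; simp
    simp [this]
  have hA : ∫⁻ σ, ‖w (r • (σ : E))‖ₑ ∂μ.toSphere ≤
      ∫⁻ s in Ioc 0 r, ∫⁻ σ, ‖fderiv ℝ w (s • ((σ : sphere (0 : E) 1) : E))‖ₑ ∂μ.toSphere := by
    refine (lintegral_mono hpt).trans_eq (lintegral_lintegral_swap ?_)
    exact (hc.comp (continuous_snd.smul
      (continuous_subtype_val.comp continuous_fst))).measurable.aemeasurable
  refine hA.trans ?_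
  -- The double integral lacks the Jacobian `s ^ (d - 1)`, so it equals the integral of `‖fderiv ℝ w
  -- y‖` over the ball with weight `‖y‖ ^ (1 - d)`. This weight is decreasing, and the comparison
  -- density `d s ^ (d - 1)` cancels it.
  have hanti : AntitoneOn (fun t : ℝ => (t ^ (d - 1))⁻¹) (Ioi 0) := by
    intro s hs t ht hst
    have hs' : (0 : ℝ) < s := hs
    exact inv_anti₀ (by positivity) (by gcongr)
  have main := setLIntegral_closedBall_antitoneOn_mul_le μ (f := fun y => ‖fderiv ℝ w y‖ₑ)
    hc.measurable.aemeasurable (K := K) (a := d) (R := r) (by exact_mod_cast hd0)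
    (by simpa only [Real.rpow_natCast] using hK) hanti (fun t ht => by positivity)
  rw [setLIntegral_closedBall_polar μ] at main
  · have hL : ∫⁻ s in Ioc 0 r, ENNReal.ofReal (s ^ (finrank ℝ E - 1)) * ∫⁻ σ,
        ENNReal.ofReal (‖s • ((σ : sphere (0 : E) 1) : E)‖ ^ (d - 1))⁻¹ *
          ‖fderiv ℝ w (s • (σ : E))‖ₑ ∂μ.toSphere =
        ∫⁻ s in Ioc 0 r, ∫⁻ σ, ‖fderiv ℝ w (s • ((σ : sphere (0 : E) 1) : E))‖ₑ ∂μ.toSphere := by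
      refine setLIntegral_congr_fun measurableSet_Ioc fun s hs => ?_
      have hs0 : 0 < s := hs.1
      have hn : ∀ σ : sphere (0 : E) 1, ‖s • (σ : E)‖ = s := fun σ => by
        simp [norm_smul, abs_of_pos hs0]
      simp only [hn]
      rw [lintegral_const_mul' _ _ ENNReal.ofReal_ne_top, ← mul_assoc,
        ← ENNReal.ofReal_mul (by positivity), mul_inv_cancel₀ (by positivity)]
      simp
    have hR : ∫⁻ s in Ioc 0 r, ENNReal.ofReal (d * s ^ ((d : ℝ) - 1)) *
        ENNReal.ofReal (s ^ (d - 1))⁻¹ = d * ENNReal.ofReal r := by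
      rw [setLIntegral_congr_fun (g := fun _ => (d : ℝ≥0∞)) measurableSet_Ioc]
      · simp
      · intro s hs
        have hs0 : 0 < s := hs.1
        beta_reduce
        rw [← ENNReal.ofReal_mul (by positivity), ← ENNReal.ofReal_natCast]
        congr 1
        rw [show (d : ℝ) - 1 = ((d - 1 : ℕ) : ℝ) by rw [Nat.cast_sub hd0]; simp,
          Real.rpow_natCast]
        field_simp
    rw [hL, hR] at main
    exact main.trans_eq (by ring)
  · refine AEMeasurable.mul ?_ hc.measurable.aemeasurable
    fun_prop

end LayerCakeBall

/-! ### Bounds for the first-order remainder. -/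

section Remainder

open Metric Module

variable {E : Type*} [NormedAddCommGroup E] [InnerProductSpace ℝ E]

/-- The remainder of the first-order expansion of `u` at `x` with slope `c`. -/
noncomputable def taylorRemainder (u : E → ℝ) (x c h : E) : ℝ :=
  u (x + h) - u x - inner ℝ c h

/-- `∫_{B(x,t)} |g - g x| ≤ K t ^ d` for all radii up to `R`. -/
def OscillationBound [MeasureSpace E] (g : E → E) (x : E) (R : ℝ) (K : ℝ≥0∞) : Prop :=
  ∀ t, 0 < t → t ≤ R →
    ∫⁻ y in closedBall x t, ‖g y - g x‖ₑ ≤ K * ENNReal.ofReal (t ^ finrank ℝ E)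

lemma OscillationBound.mono [MeasureSpace E] {g : E → E} {x : E} {R R' : ℝ} {K : ℝ≥0∞}
    (h : OscillationBound g x R K) (hR : R' ≤ R) : OscillationBound g x R' K :=
  fun t ht htR => h t ht (htR.trans hR)

/-- Bump functions with outer radius `1 / (n + 1)`, twice the inner one. -/
noncomputable def bumpSeq (E : Type*) [NormedAddCommGroup E] [InnerProductSpace ℝ E]
    (n : ℕ) : ContDiffBump (0 : E) where
  rIn := 1 / (n + 1) / 2
  rOut := 1 / (n + 1)
  rIn_pos := by positivity
  rIn_lt_rOut := half_lt_self (by positivity)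

lemma tendsto_bumpSeq_rOut : Tendsto (fun n => (bumpSeq E n).rOut) atTop (𝓝 0) :=
  tendsto_one_div_add_atTop_nhds_zero_nat

lemma bumpSeq_rOut (n : ℕ) : (bumpSeq E n).rOut = 2 * (bumpSeq E n).rIn := by
  simp only [bumpSeq]; ring

lemma contDiff_taylorRemainder {u : E → ℝ} {n : ℕ∞} (hu : ContDiff ℝ n u) (x c : E) :
    ContDiff ℝ n (taylorRemainder u x c) :=
  ((hu.comp (contDiff_const.add contDiff_id)).sub contDiff_const).sub
    (contDiff_const.inner ℝ contDiff_id)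

variable [FiniteDimensional ℝ E] [MeasureSpace E] [BorelSpace E]
  [(volume : Measure E).IsAddHaarMeasure]

lemma ae_tendsto_mollify_bumpSeq {u : E → ℝ} (hu : LocallyIntegrable u volume) :
    ∀ᵐ x, Tendsto (fun n => mollify (bumpSeq E n) u x) atTop (𝓝 (u x)) :=
  ContDiffBump.ae_convolution_tendsto_right_of_locallyIntegrable (K := 2)
    tendsto_bumpSeq_rOut (Eventually.of_forall fun n => (bumpSeq_rOut n).le) hu

lemma enorm_fderiv_taylorRemainder_mollify_le {u : E → ℝ} {g : E → E}
    (h : HasWeakGradientLoc u g) (φ : ContDiffBump (0 : E)) (x c y : E) :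
    ‖fderiv ℝ (taylorRemainder (mollify φ u) x c) y‖ₑ ≤ ‖mollify φ g (x + y) - c‖ₑ := by
  have hφ := contDiff_mollify φ h.locallyIntegrable
  simp only [enorm_eq_nnnorm, ENNReal.coe_le_coe]
  refine ContinuousLinearMap.opNNNorm_le_bound _ _ fun v => ?_
  have h1 : HasFDerivAt (fun y => mollify φ u (x + y)) (fderiv ℝ (mollify φ u) (x + y)) y := by
    have := (hφ.differentiable (by simp) (x + y)).hasFDerivAt.comp y
      ((hasFDerivAt_id y).const_add x)
    exact this
  have h2 : HasFDerivAt (fun y : E => inner ℝ c y) (innerSL ℝ c : E →L[ℝ] ℝ) y :=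
    (innerSL ℝ c : E →L[ℝ] ℝ).hasFDerivAt
  have h3 := (h1.sub_const (mollify φ u x)).sub h2
  have h4 : fderiv ℝ (taylorRemainder (mollify φ u) x c) y v =
      inner ℝ (mollify φ g (x + y) - c) v := by
    have : fderiv ℝ (taylorRemainder (mollify φ u) x c) y =
      fderiv ℝ (mollify φ u) (x + y) - (innerSL ℝ c : E →L[ℝ] ℝ) := h3.fderiv
    rw [this, sub_apply, h.fderiv_mollify, innerSL_apply_apply, inner_sub_left]
  rw [h4]
  exact nnnorm_inner_le_nnnorm _ _

/-- The gradient of the mollified remainder is the mollified gradient minus `g x`, recentred at the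
origin, so the uniform growth bound applies. -/
lemma lintegral_fderiv_taylorRemainder_mollify_le [Nontrivial E] {u : E → ℝ} {g : E → E}
    (h : HasWeakGradientLoc u g) {φ : ContDiffBump (0 : E)} (hφ : φ.rOut = 2 * φ.rIn) {x : E}
    {R : ℝ} (hφR : φ.rOut ≤ R) {K : ℝ≥0∞} (hK : OscillationBound g x (2 * R) K) {s : ℝ}
    (hs : 0 < s) (hsR : s ≤ R) :
    ∫⁻ y in closedBall 0 s, ‖fderiv ℝ (taylorRemainder (mollify φ u) x (g x)) y‖ₑ ≤
      4 ^ finrank ℝ E * K * ENNReal.ofReal (s ^ finrank ℝ E) := by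
  refine le_trans ?_ (lintegral_mollify_sub_le h.locallyIntegrable_grad hK φ hφ hφR hs hsR)
  refine (lintegral_mono fun y =>
    enorm_fderiv_taylorRemainder_mollify_le h φ x (g x) y).trans_eq ?_
  rw [← lintegral_indicator measurableSet_closedBall,
    ← lintegral_indicator measurableSet_closedBall,
    ← lintegral_add_left_eq_self ((closedBall x s).indicator _) x]
  refine lintegral_congr fun y => ?_
  simp [indicator]

lemma ae_tendsto_taylorRemainder_mollify {u : E → ℝ} (hu : LocallyIntegrable u volume) {x : E}
    (hx : Tendsto (fun n => mollify (bumpSeq E n) u x) atTop (𝓝 (u x))) (c : E) :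
    ∀ᵐ y, Tendsto (fun n => taylorRemainder (mollify (bumpSeq E n) u) x c y) atTop
      (𝓝 (taylorRemainder u x c y)) := by
  filter_upwards [(measurePreserving_add_left volume x).quasiMeasurePreserving.ae
    (ae_tendsto_mollify_bumpSeq hu)] with y hy
  exact (hy.sub hx).sub_const _

/-- Spherical means of the remainder, at a.e. radius. -/
lemma HasWeakGradientLoc.ae_lintegral_sphere_taylorRemainder_le [Nontrivial E] {u : E → ℝ}
    {g : E → E} (h : HasWeakGradientLoc u g) {x : E}
    (hx : Tendsto (fun n => mollify (bumpSeq E n) u x) atTop (𝓝 (u x))) :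
    ∀ᵐ r ∂volume.restrict (Ioi (0 : ℝ)), ∀ K, OscillationBound g x (2 * r) K →
      ∫⁻ σ, ‖taylorRemainder u x (g x) (r • ((σ : sphere (0 : E) 1) : E))‖ₑ
        ∂(volume : Measure E).toSphere ≤
        finrank ℝ E * (4 ^ finrank ℝ E * K) * ENNReal.ofReal r := by
  filter_upwards [ae_polar volume (ae_tendsto_taylorRemainder_mollify h.locallyIntegrable hx (g x)),
    ae_restrict_mem measurableSet_Ioi] with r hr hr0 K hK
  have hc : ∀ n, ContDiff ℝ ∞ (taylorRemainder (mollify (bumpSeq E n) u) x (g x)) := fun n =>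
    contDiff_taylorRemainder (contDiff_mollify _ h.locallyIntegrable) x (g x)
  -- Fatou on the sphere of radius `r`; the bound for smooth functions holds as soon as the bump
  -- radius is at most `r`, whence the radius `2 * r` in the hypothesis on `K`.
  calc _ = ∫⁻ σ, liminf (fun n => ‖taylorRemainder (mollify (bumpSeq E n) u) x (g x)
            (r • ((σ : sphere (0 : E) 1) : E))‖ₑ) atTop ∂(volume : Measure E).toSphere := by
        refine lintegral_congr_ae ?_
        filter_upwards [hr] with σ hσ
        exact (((continuous_enorm.tendsto _).comp hσ).liminf_eq).symm
    _ ≤ liminf (fun n => ∫⁻ σ, ‖taylorRemainder (mollify (bumpSeq E n) u) x (g x)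
            (r • ((σ : sphere (0 : E) 1) : E))‖ₑ ∂(volume : Measure E).toSphere) atTop := by
        refine lintegral_liminf_le fun n => ?_
        exact ((hc n).continuous.comp (by fun_prop)).enorm.measurable
    _ ≤ _ := by
        refine liminf_le_of_frequently_le' (Eventually.frequently ?_)
        filter_upwards [(tendsto_bumpSeq_rOut (E := E)).eventually (ge_mem_nhds hr0)] with n hn
        refine lintegral_sphere_enorm_le_of_fderiv volume ((hc n).of_le (by simp)) ?_ hr0 ?_
        · simp [taylorRemainder]
        · intro s hs hsr
          exact lintegral_fderiv_taylorRemainder_mollify_le h (bumpSeq_rOut n) hn hK hs hsr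

/-- Obtained by integrating the spherical bound over the radii. It controls the term `w ∇χ` produced
by a cutoff `χ`. -/
lemma setLIntegral_closedBall_enorm_le_of_fderiv [Nontrivial E] {w : E → ℝ}
    (hw : ContDiff ℝ 1 w) (hw0 : w 0 = 0) {K : ℝ≥0∞} {r : ℝ}
    (hK : ∀ s, 0 < s → s ≤ r →
      ∫⁻ y in closedBall 0 s, ‖fderiv ℝ w y‖ₑ ≤ K * ENNReal.ofReal (s ^ finrank ℝ E)) :
    ∫⁻ y in closedBall 0 r, ‖w y‖ₑ ≤
      finrank ℝ E * K * ENNReal.ofReal (r ^ finrank ℝ E) * ENNReal.ofReal r := by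
  set d := finrank ℝ E with hd
  have hd0 : 0 < d := finrank_pos
  rw [setLIntegral_closedBall_polar volume hw.continuous.enorm.measurable.aemeasurable]
  calc _ ≤ ∫⁻ s in Ioc 0 r, d * K * ENNReal.ofReal (r ^ d) := by
        refine setLIntegral_mono' measurableSet_Ioc fun s hs => ?_
        have hs0 : 0 < s := hs.1
        calc _ ≤ ENNReal.ofReal (s ^ (d - 1)) * (d * K * ENNReal.ofReal s) := by
              gcongr
              exact lintegral_sphere_enorm_le_of_fderiv volume hw hw0 hs0
                fun t ht hts => hK t ht (hts.trans hs.2)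
          _ = d * K * ENNReal.ofReal (s ^ d) := by
              rw [mul_left_comm, ← ENNReal.ofReal_mul (by positivity), ← pow_succ,
                Nat.sub_add_cancel hd0]
          _ ≤ _ := by
              gcongr
              exact hs.2
    _ = _ := by simp

/-- The Gagliardo-Nirenberg-Sobolev inequality is applied to `χ w`, with `χ = 1` on `B_r` and
support in `B_{2r}`. Since `|∇χ| ≤ C₀ / r` and `∫_{B_{2r}} |w|` is of order `K r ^ (d + 1)`, both
terms of the gradient have order `K r ^ d`. -/
lemma eLpNorm_restrict_closedBall_le_of_fderiv [Nontrivial E] {q : NNReal}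
    (hq : NNReal.HolderConjugate (finrank ℝ E) q) :
    ∃ C : ℝ≥0∞, C ≠ ⊤ ∧ ∀ (w : E → ℝ) (K : ℝ≥0∞) (r : ℝ), ContDiff ℝ 1 w → w 0 = 0 → 0 < r →
      (∀ s, 0 < s → s ≤ 2 * r →
        ∫⁻ y in closedBall 0 s, ‖fderiv ℝ w y‖ₑ ≤ K * ENNReal.ofReal (s ^ finrank ℝ E)) →
      eLpNorm w q (volume.restrict (closedBall 0 r)) ≤
        C * K * ENNReal.ofReal (r ^ finrank ℝ E) := by
  set d := finrank ℝ E with hd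
  let χ₀ : ContDiffBump (0 : E) := ⟨1, 2, one_pos, one_lt_two⟩
  have hχ₀ : ContDiff ℝ 1 χ₀ := χ₀.contDiff
  obtain ⟨C₀, hC₀⟩ := (hχ₀.continuous_fderiv (by simp)).bounded_above_of_compact_support
    (χ₀.hasCompactSupport.fderiv ℝ)
  have hC₀0 : 0 ≤ C₀ := (norm_nonneg _).trans (hC₀ 0)
  refine ⟨eLpNormLESNormFDerivOneConst (volume : Measure E) q *
    ((1 + ENNReal.ofReal C₀ * (d * 2)) * 2 ^ d), by finiteness, fun w K r hw hw0 hr hK => ?_⟩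
  set χ : E → ℝ := fun y => χ₀ (r⁻¹ • y)
  have hχ : ContDiff ℝ 1 χ := hχ₀.comp (contDiff_const.smul contDiff_id)
  have hχ1 : ∀ y ∈ closedBall (0 : E) r, χ y = 1 := by
    intro y hy
    refine χ₀.one_of_mem_closedBall ?_
    simp only [mem_closedBall, dist_zero_right, norm_smul, norm_inv, Real.norm_eq_abs,
      abs_of_pos hr] at hy ⊢
    change _ ≤ (1 : ℝ)
    rw [inv_mul_le_iff₀ hr]; linarith
  have hχsupp : ∀ y, y ∉ closedBall (0 : E) (2 * r) → χ y = 0 := by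
    intro y hy
    refine χ₀.zero_of_le_dist ?_
    simp only [mem_closedBall, dist_zero_right, norm_smul, norm_inv, Real.norm_eq_abs,
      abs_of_pos hr, not_le] at hy ⊢
    change (2 : ℝ) ≤ _
    rw [le_inv_mul_iff₀ hr]; linarith
  have hcs : HasCompactSupport fun y => χ y * w y :=
    HasCompactSupport.intro (isCompact_closedBall 0 (2 * r)) fun y hy => by simp [hχsupp y hy]
  have hχd : ∀ y, ‖fderiv ℝ χ y‖ ≤ C₀ / r := by
    intro y
    have h1 : fderiv ℝ χ y = r⁻¹ • fderiv ℝ χ₀ (r⁻¹ • y) := fderiv_comp_smul r⁻¹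
    rw [h1, norm_smul, norm_inv, Real.norm_eq_abs, abs_of_pos hr, div_eq_inv_mul]
    gcongr
    exact hC₀ _
  have hprod : ∀ y, ‖fderiv ℝ (fun y => χ y * w y) y‖ₑ ≤ (closedBall (0 : E) (2 * r)).indicator
      (fun y => ‖fderiv ℝ w y‖ₑ + ENNReal.ofReal (C₀ / r) * ‖w y‖ₑ) y := by
    intro y
    by_cases hy : y ∈ closedBall (0 : E) (2 * r)
    · rw [indicator_of_mem hy, fderiv_fun_mul (hχ.differentiable (by simp) y)
        (hw.differentiable (by simp) y)]
      rw [← ofReal_norm, ← ofReal_norm, ← ofReal_norm, ← ENNReal.ofReal_mul (by positivity),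
        ← ENNReal.ofReal_add (by positivity) (by positivity)]
      refine ENNReal.ofReal_le_ofReal ((norm_add_le _ _).trans ?_)
      rw [norm_smul, norm_smul, mul_comm ‖w y‖]
      gcongr
      · refine mul_le_of_le_one_left (norm_nonneg _) ?_
        rw [Real.norm_of_nonneg χ₀.nonneg]
        exact χ₀.le_one
      · exact hχd y
    · rw [indicator_of_notMem hy]
      have : (fun y => χ y * w y) =ᶠ[𝓝 y] fun _ => 0 := by
        filter_upwards [isClosed_closedBall.isOpen_compl.mem_nhds hy] with z hz
        simp [hχsupp z hz]
      rw [this.fderiv_eq, ← ofReal_norm]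
      simp
  calc eLpNorm w q (volume.restrict (closedBall 0 r))
      = eLpNorm (fun y => χ y * w y) q (volume.restrict (closedBall 0 r)) := by
        refine eLpNorm_congr_ae ?_
        filter_upwards [ae_restrict_mem measurableSet_closedBall] with y hy
        rw [hχ1 y hy, one_mul]
    _ ≤ eLpNorm (fun y => χ y * w y) q volume := eLpNorm_mono_measure _ Measure.restrict_le_self
    _ ≤ eLpNormLESNormFDerivOneConst (volume : Measure E) q *
        eLpNorm (fderiv ℝ fun y => χ y * w y) 1 volume :=
        eLpNorm_le_eLpNorm_fderiv_one volume (hχ.mul hw) hcs hq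
    _ ≤ eLpNormLESNormFDerivOneConst (volume : Measure E) q *
        ((1 + ENNReal.ofReal C₀ * (d * 2)) * 2 ^ d * K * ENNReal.ofReal (r ^ d)) := by
        gcongr
        rw [eLpNorm_one_eq_lintegral_enorm]
        refine (lintegral_mono hprod).trans ?_
        rw [lintegral_indicator measurableSet_closedBall,
          lintegral_add_left (hw.continuous_fderiv (by simp)).enorm.measurable,
          lintegral_const_mul' _ _ ENNReal.ofReal_ne_top]
        calc _ ≤ K * ENNReal.ofReal ((2 * r) ^ d) + ENNReal.ofReal (C₀ / r) *
              (d * K * ENNReal.ofReal ((2 * r) ^ d) * ENNReal.ofReal (2 * r)) := by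
              gcongr
              · exact hK _ (by positivity) le_rfl
              · exact setLIntegral_closedBall_enorm_le_of_fderiv hw hw0 hK
          _ = K * ENNReal.ofReal ((2 * r) ^ d) +
              (ENNReal.ofReal (C₀ / r) * ENNReal.ofReal (2 * r)) *
              (d * K * ENNReal.ofReal ((2 * r) ^ d)) := by ring
          _ = _ := by
              rw [← ENNReal.ofReal_mul (by positivity),
                show C₀ / r * (2 * r) = C₀ * 2 by field_simp, mul_pow,
                ENNReal.ofReal_mul (by positivity), ENNReal.ofReal_pow (by norm_num),
                ENNReal.ofReal_mul (p := C₀) hC₀0]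
              simp only [ENNReal.ofReal_ofNat]
              ring
    _ = _ := by ring

lemma AEStronglyMeasurable.taylorRemainder {u : E → ℝ} (hu : AEStronglyMeasurable u volume)
    (x c : E) : AEStronglyMeasurable (taylorRemainder u x c) volume :=
  ((hu.comp_measurePreserving (measurePreserving_add_left volume x)).sub
    aestronglyMeasurable_const).sub (by fun_prop)

/-- The Sobolev bound for the remainder on balls. -/
lemma HasWeakGradientLoc.exists_eLpNorm_taylorRemainder_le [Nontrivial E] {q : NNReal}
    (hq : NNReal.HolderConjugate (finrank ℝ E) q) :
    ∃ C : ℝ≥0∞, C ≠ ⊤ ∧ ∀ {u : E → ℝ} {g : E → E}, HasWeakGradientLoc u g → ∀ {x : E},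
      Tendsto (fun n => mollify (bumpSeq E n) u x) atTop (𝓝 (u x)) → ∀ {r : ℝ}, 0 < r →
      ∀ {K : ℝ≥0∞}, OscillationBound g x (4 * r) K →
      eLpNorm (taylorRemainder u x (g x)) q (volume.restrict (closedBall 0 r)) ≤
        C * K * ENNReal.ofReal (r ^ finrank ℝ E) := by
  obtain ⟨C, hC, hS⟩ := eLpNorm_restrict_closedBall_le_of_fderiv (E := E) hq
  refine ⟨C * 4 ^ finrank ℝ E, by finiteness, fun {u g} h {x} hx {r} hr {K} hK => ?_⟩
  have hc : ∀ n, ContDiff ℝ ∞ (taylorRemainder (mollify (bumpSeq E n) u) x (g x)) := fun n =>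
    contDiff_taylorRemainder (contDiff_mollify _ h.locallyIntegrable) x (g x)
  refine (Lp.eLpNorm_lim_le_liminf_eLpNorm (fun n => (hc n).continuous.aestronglyMeasurable)
    _ (ae_restrict_of_ae
      (ae_tendsto_taylorRemainder_mollify h.locallyIntegrable hx (g x)))).trans ?_
  refine liminf_le_of_frequently_le' (Eventually.frequently ?_)
  filter_upwards [(tendsto_bumpSeq_rOut (E := E)).eventually
    (ge_mem_nhds (show 0 < 2 * r by positivity))] with n hn
  refine (hS _ (4 ^ finrank ℝ E * K) r ((hc n).of_le (by simp)) (by simp [taylorRemainder]) hr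
    fun s hs hsr => ?_).trans_eq (by ring)
  exact lintegral_fderiv_taylorRemainder_mollify_le h (bumpSeq_rOut n) hn
    (by convert hK using 1; ring) hs hsr

/-- Growth of the `p`-th power of the remainder on balls, up to the Sobolev exponent. -/
lemma HasWeakGradientLoc.exists_lintegral_rpow_taylorRemainder_le [Nontrivial E] {q : NNReal}
    (hq : NNReal.HolderConjugate (finrank ℝ E) q) {p : ℝ} (hp : 1 ≤ p) (hpq : p ≤ q) :
    ∃ C : ℝ≥0∞, C ≠ ⊤ ∧ ∀ {u : E → ℝ} {g : E → E}, HasWeakGradientLoc u g → ∀ {x : E},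
      Tendsto (fun n => mollify (bumpSeq E n) u x) atTop (𝓝 (u x)) → ∀ {r : ℝ}, 0 < r →
      ∀ {K : ℝ≥0∞}, OscillationBound g x (4 * r) K →
      ∫⁻ y in closedBall 0 r, ‖taylorRemainder u x (g x) y‖ₑ ^ p ≤
        C * K ^ p * ENNReal.ofReal (r ^ (finrank ℝ E + p)) := by
  obtain ⟨C, hC, hS⟩ := HasWeakGradientLoc.exists_eLpNorm_taylorRemainder_le (E := E) hq
  set d := finrank ℝ E with hd
  set b : ℝ≥0∞ := volume (ball (0 : E) 1)
  have hp0 : 0 < p := by linarith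
  have hq0 : (0 : ℝ) < q := by linarith
  have hexp : 0 ≤ 1 / p - 1 / q := sub_nonneg.2 (one_div_le_one_div_of_le hp0 hpq)
  have hb : b ≠ ⊤ := measure_ball_lt_top.ne
  refine ⟨(C * b ^ (1 / p - 1 / (q : ℝ))) ^ p, by finiteness, fun {u g} h {x} hx {r} hr {K} hK => ?_⟩
  have hm := (AEStronglyMeasurable.taylorRemainder h.locallyIntegrable.aestronglyMeasurable x
    (g x)).restrict (s := closedBall 0 r)
  -- Hölder's inequality on the ball lowers the Sobolev exponent `q` to `p`.
  have h1 := eLpNorm_le_eLpNorm_mul_rpow_measure_univ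
    (p := ENNReal.ofReal p) (q := (q : ℝ≥0∞)) (by
      rw [← ENNReal.ofReal_coe_nnreal]; exact ENNReal.ofReal_le_ofReal hpq) hm
  rw [eLpNorm_eq_lintegral_rpow_enorm_toReal (by simpa using hp0) (by simp),
    ENNReal.toReal_ofReal hp0.le, ENNReal.coe_toReal, Measure.restrict_apply_univ,
    Measure.addHaar_closedBall _ _ hr.le] at h1
  have h2 := ENNReal.rpow_le_rpow (h1.trans (mul_le_mul_left (hS h hx hr hK) _)) hp0.le
  rw [← ENNReal.rpow_mul, one_div_mul_cancel hp0.ne', ENNReal.rpow_one] at h2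
  refine h2.trans_eq ?_
  have hdq : (d : ℝ) * (1 / (q : ℝ)) = d - 1 := by
    have h3 := hq.coe.inv_add_inv_eq_one
    have h4 : ((d : NNReal) : ℝ) ≠ 0 := hq.coe.ne_zero
    simp only [NNReal.coe_natCast] at h3 h4
    rw [one_div, show (q : ℝ)⁻¹ = 1 - (d : ℝ)⁻¹ by linarith]
    field_simp
  rw [ENNReal.mul_rpow_of_nonneg _ _ hexp, ENNReal.mul_rpow_of_nonneg _ _ hp0.le,
    ENNReal.mul_rpow_of_nonneg _ _ hp0.le, ENNReal.mul_rpow_of_nonneg _ _ hp0.le,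
    ENNReal.mul_rpow_of_nonneg _ _ hp0.le, ENNReal.mul_rpow_of_nonneg _ _ hp0.le,
    ENNReal.ofReal_rpow_of_pos (by positivity), ENNReal.ofReal_rpow_of_pos (by positivity),
    ENNReal.ofReal_rpow_of_pos (by positivity)]
  -- Exponent count: `d p + d (1 / p - 1 / q) p = d p + d - (d - 1) p = d + p`, using `d / q = d -
  -- 1`.
  have hr' : ENNReal.ofReal (r ^ ((d : ℝ) + p)) = ENNReal.ofReal ((r ^ d) ^ p) *
      ENNReal.ofReal (((r ^ d) ^ (1 / p - 1 / (q : ℝ))) ^ p) := by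
    rw [← ENNReal.ofReal_mul (by positivity)]
    congr 1
    rw [← Real.rpow_natCast, ← Real.rpow_mul hr.le, ← Real.rpow_mul hr.le, ← Real.rpow_mul hr.le,
      ← Real.rpow_add hr]
    congr 1
    rw [mul_sub, hdq]
    field_simp
    ring
  rw [hr']
  ring

end Remainder

/-! ### Lebesgue points of the gradient. -/

section LebesguePoints

open Metric Module

variable {E : Type*} [NormedAddCommGroup E] [InnerProductSpace ℝ E] [FiniteDimensional ℝ E]
  [MeasureSpace E] [BorelSpace E] [(volume : Measure E).IsAddHaarMeasure]

lemma ae_exists_oscillationBound_of_pos [Nontrivial E] {g : E → E}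
    (hg : LocallyIntegrable g volume) :
    ∀ᵐ x, ∀ η : ℝ≥0∞, 0 < η → ∃ δ : ℝ, 0 < δ ∧ OscillationBound g x δ η := by
  filter_upwards [(Besicovitch.vitaliFamily (volume : Measure E)).ae_tendsto_lintegral_enorm_sub_div
    hg] with x hx η hη
  have h1 := hx.comp (Besicovitch.tendsto_filterAt (volume : Measure E) x)
  set b : ℝ≥0∞ := volume (ball (0 : E) 1) with hb
  have hb0 : b ≠ 0 := (measure_ball_pos _ _ one_pos).ne'
  have hbt : b ≠ ⊤ := measure_ball_lt_top.ne
  -- The threshold is `η / b` because `OscillationBound` is normalised by `t ^ d` instead of the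
  -- volume `b t ^ d` of the ball.
  have h2 := h1.eventually (ge_mem_nhds (ENNReal.div_pos hη.ne' hbt))
  obtain ⟨δ, hδ, hδ'⟩ := mem_nhdsGT_iff_exists_Ioc_subset.1 h2
  refine ⟨δ, hδ, fun t ht htδ => ?_⟩
  have h3 : (∫⁻ y in closedBall x t, ‖g y - g x‖ₑ) / volume (closedBall x t) ≤ η / b :=
    hδ' ⟨ht, htδ⟩
  rw [Measure.addHaar_closedBall _ _ ht.le, ← hb] at h3
  have ht0 : ENNReal.ofReal (t ^ finrank ℝ E) ≠ 0 := by simpa using pow_pos ht _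
  rw [ENNReal.div_le_iff (mul_ne_zero ht0 hb0) (ENNReal.mul_ne_top ENNReal.ofReal_ne_top hbt)] at h3
  refine h3.trans_eq ?_
  rw [mul_comm (ENNReal.ofReal _), ← mul_assoc, ENNReal.div_mul_cancel hb0 hbt]

-- Beyond `δ`, local integrability bounds the integral over the largest ball, and `t ^ d ≥ δ ^ d`.
omit [BorelSpace E] in
lemma exists_oscillationBound {g : E → E} (hg : LocallyIntegrable g volume) {x : E} {δ : ℝ}
    (hδ : 0 < δ) (h : OscillationBound g x δ 1) (R : ℝ) :
    ∃ K : ℝ≥0∞, K ≠ ⊤ ∧ OscillationBound g x R K := by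
  have hI : ∫⁻ y in closedBall x R, ‖g y - g x‖ₑ ≠ ⊤ := by
    have : IntegrableOn (fun y => g y - g x) (closedBall x R) volume :=
      (hg.sub (locallyIntegrable_const _)).integrableOn_isCompact (isCompact_closedBall x R)
    exact this.2.ne
  have hδ0 : ENNReal.ofReal (δ ^ finrank ℝ E) ≠ 0 := by simpa using pow_pos hδ _
  refine ⟨max 1 ((∫⁻ y in closedBall x R, ‖g y - g x‖ₑ) / ENNReal.ofReal (δ ^ finrank ℝ E)),
    (max_lt ENNReal.one_lt_top (ENNReal.div_lt_top hI hδ0)).ne, fun t ht htR => ?_⟩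
  rcases le_or_gt t δ with htδ | htδ
  · exact (h t ht htδ).trans (by gcongr; exact le_max_left _ _)
  · calc _ ≤ ∫⁻ y in closedBall x R, ‖g y - g x‖ₑ :=
          lintegral_mono_set (closedBall_subset_closedBall htR)
      _ = (∫⁻ y in closedBall x R, ‖g y - g x‖ₑ) / ENNReal.ofReal (δ ^ finrank ℝ E) *
          ENNReal.ofReal (δ ^ finrank ℝ E) :=
          (ENNReal.div_mul_cancel hδ0 ENNReal.ofReal_ne_top).symm
      _ ≤ _ := by
          gcongr
          exact le_max_right _ _

/-- The points at which the first-order expansion of `u` with slope `g` is controlled. -/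
structure IsGoodPoint (u : E → ℝ) (g : E → E) (x : E) : Prop where
  tendsto_mollify : Tendsto (fun n => mollify (bumpSeq E n) u x) atTop (𝓝 (u x))
  exists_bound : ∀ R, ∃ K : ℝ≥0∞, K ≠ ⊤ ∧ OscillationBound g x R K
  small : ∀ η : ℝ≥0∞, 0 < η → ∃ δ : ℝ, 0 < δ ∧ OscillationBound g x δ η

lemma HasWeakGradientLoc.ae_isGoodPoint [Nontrivial E] {u : E → ℝ} {g : E → E}
    (h : HasWeakGradientLoc u g) : ∀ᵐ x, IsGoodPoint u g x := by
  filter_upwards [ae_tendsto_mollify_bumpSeq h.locallyIntegrable,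
    ae_exists_oscillationBound_of_pos h.locallyIntegrable_grad] with x hx hs
  obtain ⟨δ, hδ, hδ'⟩ := hs 1 one_pos
  exact ⟨hx, exists_oscillationBound h.locallyIntegrable_grad hδ hδ', hs⟩

end LebesguePoints

/-! ### Integration against radial mollifiers. -/

section Mollifiers

namespace IsRadialMollifier

variable {d : ℕ} {ρ : ℕ → ℝ → ℝ}

lemma integrableOn (h : IsRadialMollifier d ρ) (n : ℕ) :
    IntegrableOn (fun r => ρ n r * r ^ (d - 1)) (Ioi 0) := by
  -- A non-integrable function would have Bochner integral `0`, contradicting unit mass.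
  by_contra hn
  have := h.integral_eq_one n
  rw [integral_undef hn] at this
  exact zero_ne_one this

lemma aemeasurable (h : IsRadialMollifier d ρ) (n : ℕ) :
    AEMeasurable (ρ n) (volume.restrict (Ioi 0)) :=
  (h.locallyIntegrableOn n).aestronglyMeasurable.aemeasurable

lemma nonneg_mul (h : IsRadialMollifier d ρ) (n : ℕ) {r : ℝ} (hr : 0 < r) :
    0 ≤ ρ n r * r ^ (d - 1) :=
  mul_nonneg (h.nonneg n r hr) (pow_nonneg hr.le _)

lemma lintegral_eq_one (h : IsRadialMollifier d ρ) (n : ℕ) :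
    ∫⁻ r in Ioi (0 : ℝ), ENNReal.ofReal (ρ n r * r ^ (d - 1)) = 1 := by
  rw [← ofReal_integral_eq_lintegral_ofReal (h.integrableOn n), h.integral_eq_one,
    ENNReal.ofReal_one]
  filter_upwards [ae_restrict_mem measurableSet_Ioi] with r hr using h.nonneg_mul n hr

lemma tendsto_lintegral_zero (h : IsRadialMollifier d ρ) {δ : ℝ} (hδ : 0 < δ) :
    Tendsto (fun n => ∫⁻ r in Ioi δ, ENNReal.ofReal (ρ n r * r ^ (d - 1))) atTop (𝓝 0) := by
  have h1 := ENNReal.tendsto_ofReal (h.tendsto_zero δ hδ)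
  rw [ENNReal.ofReal_zero] at h1
  refine h1.congr fun n => ?_
  rw [ofReal_integral_eq_lintegral_ofReal ((h.integrableOn n).mono_set (Ioi_subset_Ioi hδ.le))]
  filter_upwards [ae_restrict_mem measurableSet_Ioi] with r hr
  exact h.nonneg_mul n (hδ.trans hr)

/-- Integrals of functions vanishing at `0` against radial mollifiers tend to `0`. -/
lemma tendsto_lintegral_mul (h : IsRadialMollifier d ρ) {a : ℝ → ℝ≥0∞}
    (ha : ∀ η : ℝ≥0∞, 0 < η → ∃ δ : ℝ, 0 < δ ∧
      ∀ᵐ r ∂volume.restrict (Ioi (0 : ℝ)), r ≤ δ → a r ≤ η)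
    (ha1 : ∃ K : ℝ≥0∞, K ≠ ⊤ ∧ ∀ᵐ r ∂volume.restrict (Ioi (0 : ℝ)), r ≤ 1 → a r ≤ K) :
    Tendsto (fun n => ∫⁻ r in Ioi (0 : ℝ), ENNReal.ofReal (ρ n r * r ^ (d - 1)) * a r) atTop
      (𝓝 0) := by
  rw [ENNReal.tendsto_nhds_zero]
  intro ε hε
  obtain ⟨δ, hδ, hδa⟩ := ha (ε / 2) (ENNReal.half_pos hε.ne')
  obtain ⟨K, hK, hKa⟩ := ha1
  have h1 : Tendsto (fun n => K * ∫⁻ r in Ioi δ, ENNReal.ofReal (ρ n r * r ^ (d - 1))) atTop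
      (𝓝 0) := by
    simpa using ENNReal.Tendsto.const_mul (h.tendsto_lintegral_zero hδ) (Or.inr hK)
  filter_upwards [h1.eventually (ge_mem_nhds (ENNReal.half_pos hε.ne'))] with n hn
  have hm : AEMeasurable (fun r => ENNReal.ofReal (ρ n r * r ^ (d - 1)))
      (volume.restrict (Ioi 0)) := ((h.aemeasurable n).mul (by fun_prop)).ennreal_ofReal
  -- Below `δ`, `a` is small and the mass is one; on `(δ, 1]`, `a` is bounded by `K` and the mass
  -- tends to zero; beyond `1`, `ρ n` vanishes.
  calc _ ≤ ∫⁻ r in Ioi (0 : ℝ), (ENNReal.ofReal (ρ n r * r ^ (d - 1)) * (ε / 2) +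
        K * (Ioi δ).indicator (fun r => ENNReal.ofReal (ρ n r * r ^ (d - 1))) r) := by
        refine lintegral_mono_ae ?_
        filter_upwards [hδa, hKa] with r hr1 hr2
        rcases le_or_gt r δ with hr | hr
        · exact le_add_of_le_of_nonneg (by gcongr; exact hr1 hr) zero_le
        · rcases le_or_gt r 1 with hr' | hr'
          · rw [indicator_of_mem (mem_Ioi.2 hr), mul_comm K]
            exact le_add_of_nonneg_of_le zero_le (by gcongr; exact hr2 hr')
          · simp [h.eq_zero n r hr']
    _ = ε / 2 + K * ∫⁻ r in Ioi δ, ENNReal.ofReal (ρ n r * r ^ (d - 1)) := by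
        rw [lintegral_add_left' (hm.mul_const _), lintegral_mul_const'' _ hm, h.lintegral_eq_one,
          one_mul, lintegral_const_mul' _ _ hK, lintegral_indicator measurableSet_Ioi,
          Measure.restrict_restrict measurableSet_Ioi,
          inter_eq_left.2 (Ioi_subset_Ioi hδ.le)]
    _ ≤ ε / 2 + ε / 2 := by gcongr
    _ = ε := ENNReal.add_halves ε

/-- By monotonicity, `ρ n δ * (δ / 2) ^ d` is at most the mass on `(δ / 2, δ]`, which tends to zero.
-/
lemma tendsto_ofReal_of_antitoneOn (h : IsRadialMollifier d ρ) (hd : 0 < d)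
    (ha : ∀ n, AntitoneOn (ρ n) (Ioi 0)) {δ : ℝ} (hδ : 0 < δ) :
    Tendsto (fun n => ENNReal.ofReal (ρ n δ)) atTop (𝓝 0) := by
  have hδ2 : 0 < δ / 2 := half_pos hδ
  set c : ℝ≥0∞ := ENNReal.ofReal ((δ / 2) ^ d) with hc
  have hc0 : c ≠ 0 := by simpa [hc] using pow_pos hδ2 d
  have h1 : Tendsto (fun n => (∫⁻ r in Ioi (δ / 2), ENNReal.ofReal (ρ n r * r ^ (d - 1))) / c)
      atTop (𝓝 0) := by
    simpa using ENNReal.Tendsto.div_const (h.tendsto_lintegral_zero hδ2) (Or.inr hc0)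
  refine tendsto_of_tendsto_of_tendsto_of_le_of_le tendsto_const_nhds h1 (fun _ => zero_le)
    fun n => ?_
  rw [ENNReal.le_div_iff_mul_le (Or.inl hc0) (Or.inl ENNReal.ofReal_ne_top)]
  calc ENNReal.ofReal (ρ n δ) * c
      = ∫⁻ r in Ioc (δ / 2) δ, ENNReal.ofReal (ρ n δ * (δ / 2) ^ (d - 1)) := by
        rw [setLIntegral_const, Real.volume_Ioc, hc, ← ENNReal.ofReal_mul (h.nonneg n δ hδ),
          ← ENNReal.ofReal_mul (mul_nonneg (h.nonneg n δ hδ) (by positivity))]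
        congr 1
        rw [show δ - δ / 2 = δ / 2 by ring, mul_assoc, ← pow_succ, Nat.sub_add_cancel hd]
    _ ≤ ∫⁻ r in Ioc (δ / 2) δ, ENNReal.ofReal (ρ n r * r ^ (d - 1)) := by
        refine setLIntegral_mono' measurableSet_Ioc fun r hr => ENNReal.ofReal_le_ofReal ?_
        have hr0 : 0 < r := hδ2.trans hr.1
        have := ha n hr0 hδ hr.2
        have := h.nonneg n r hr0
        gcongr
        exact hr.1.le
    _ ≤ _ := lintegral_mono_set Ioc_subset_Ioi_self

end IsRadialMollifier

end Mollifiers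

/-! ### The radially weighted energy and its inequalities. -/

section WeightedEnergy

open Metric Module

variable {E : Type*} [NormedAddCommGroup E] [InnerProductSpace ℝ E] [FiniteDimensional ℝ E]
  [Nontrivial E] [MeasureSpace E] [BorelSpace E] [(volume : Measure E).IsAddHaarMeasure]

/-- `∫ (|f(h)| / |h|) ^ p ρ(|h|) dh`. -/
noncomputable def radialEnergy (ρ : ℝ → ℝ) (p : ℝ) (f : E → ℝ) : ℝ≥0∞ :=
  ∫⁻ h, ENNReal.ofReal (ρ ‖h‖) * (‖f h‖ₑ / ‖h‖ₑ) ^ p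

lemma radialEnergy_polar {ρ : ℝ → ℝ} (hρ : AEMeasurable ρ (volume.restrict (Ioi 0)))
    (hρ0 : ∀ r, 0 < r → 0 ≤ ρ r) (p : ℝ) {f : E → ℝ} (hf : AEStronglyMeasurable f volume) :
    radialEnergy ρ p f = ∫⁻ r in Ioi (0 : ℝ), ENNReal.ofReal (ρ r * r ^ (finrank ℝ E - 1)) *
      ∫⁻ σ, (‖f (r • ((σ : sphere (0 : E) 1) : E))‖ₑ / ENNReal.ofReal r) ^ p
        ∂(volume : Measure E).toSphere := by
  rw [radialEnergy, lintegral_norm_mul_polar volume (w := fun r => ENNReal.ofReal (ρ r))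
    (f := fun h => (‖f h‖ₑ / ‖h‖ₑ) ^ p) hρ.ennreal_ofReal (by simp)
    ((hf.enorm.div (by fun_prop)).pow_const p)]
  refine setLIntegral_congr_fun measurableSet_Ioi fun r hr => ?_
  have hr0 : 0 < r := hr
  have hn : ∀ σ : sphere (0 : E) 1, ‖r • (σ : E)‖ₑ = ENNReal.ofReal r := fun σ => by
    rw [← ofReal_norm]; simp [norm_smul, abs_of_pos hr0]
  simp only [hn]
  rw [← mul_assoc, ← ENNReal.ofReal_mul (hρ0 r hr0)]

/-- The quotient `|⟪c, r σ⟫| / r` is independent of `r`, so the radial integral contributes only the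
total mass `1`. -/
lemma radialEnergy_inner {ρ : ℕ → ℝ → ℝ} (hρ : IsRadialMollifier (finrank ℝ E) ρ) (n : ℕ)
    (p : ℝ) (c : E) : radialEnergy (ρ n) p (fun h : E => inner ℝ c h) =
      ∫⁻ σ, ‖(inner ℝ c ((σ : sphere (0 : E) 1) : E) : ℝ)‖ₑ ^ p
        ∂(volume : Measure E).toSphere := by
  rw [radialEnergy_polar (hρ.aemeasurable n) (hρ.nonneg n) p (by fun_prop)]
  rw [setLIntegral_congr_fun (g := fun r => ENNReal.ofReal (ρ n r * r ^ (finrank ℝ E - 1)) *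
      ∫⁻ σ, ‖(inner ℝ c ((σ : sphere (0 : E) 1) : E) : ℝ)‖ₑ ^ p
        ∂(volume : Measure E).toSphere) measurableSet_Ioi]
  · rw [lintegral_mul_const'', hρ.lintegral_eq_one, one_mul]
    exact ((hρ.aemeasurable n).mul (by fun_prop)).ennreal_ofReal
  · intro r hr
    have hr0 : 0 < r := hr
    have hr' : ENNReal.ofReal r ≠ 0 := by simpa using hr0
    beta_reduce
    congr 1
    refine lintegral_congr fun σ => ?_
    rw [inner_smul_right, enorm_mul, Real.enorm_of_nonneg hr0.le, mul_comm,
      ENNReal.mul_div_cancel_right hr' ENNReal.ofReal_ne_top]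

omit [Nontrivial E] in
lemma lintegral_enorm_inner_rpow_ne_top {p : ℝ} (hp : 0 ≤ p) (c : E) :
    ∫⁻ σ, ‖(inner ℝ c ((σ : sphere (0 : E) 1) : E) : ℝ)‖ₑ ^ p
      ∂(volume : Measure E).toSphere ≠ ⊤ := by
  refine ((lintegral_mono (g := fun _ => ‖c‖ₑ ^ p) fun σ => ?_).trans_lt ?_).ne
  · refine ENNReal.rpow_le_rpow ?_ hp
    rw [← ofReal_norm, ← ofReal_norm]
    refine ENNReal.ofReal_le_ofReal ((norm_inner_le_norm _ _).trans ?_)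
    simp
  · rw [lintegral_const]
    exact ENNReal.mul_lt_top (by finiteness) (measure_lt_top _ _)

lemma nonlocalEnergy_eq_radialEnergy {ρ : ℝ → ℝ} (hρ0 : ∀ r, 0 < r → 0 ≤ ρ r) {p : ℝ}
    (hp : 0 ≤ p) (u : E → ℝ) (x c : E) :
    nonlocalEnergy ρ p u x =
      radialEnergy ρ p (fun h => inner ℝ c h + taylorRemainder u x c h) := by
  rw [nonlocalEnergy, radialEnergy, ← lintegral_add_left_eq_self _ x]
  refine lintegral_congr_ae ?_
  filter_upwards [measure_eq_zero_iff_ae_notMem.1 (measure_singleton (μ := volume) (0 : E))] with h hh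
  have hh0 : 0 < ‖h‖ := by simpa using hh
  have h1 : ‖x - (x + h)‖ = ‖h‖ := by simp
  have h2 : inner ℝ c h + taylorRemainder u x c h = -(u x - u (x + h)) := by
    unfold taylorRemainder; ring
  rw [h1, h2, enorm_neg, mul_comm, ENNReal.ofReal_mul (hρ0 _ hh0)]
  congr 1
  rw [← Real.div_rpow (abs_nonneg _) hh0.le, ← ENNReal.ofReal_rpow_of_nonneg (by positivity) hp,
    ENNReal.ofReal_div_of_pos hh0, ofReal_norm, ← Real.norm_eq_abs, ofReal_norm]

/-- The measure `ρ(|h|) dh`. -/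
noncomputable def radialMeasure (E : Type*) [NormedAddCommGroup E] [MeasureSpace E]
    (ρ : ℝ → ℝ) : Measure E :=
  volume.withDensity fun h => ENNReal.ofReal (ρ ‖h‖)

lemma aemeasurable_ofReal_norm {ρ : ℝ → ℝ} (hρ : AEMeasurable ρ (volume.restrict (Ioi 0))) :
    AEMeasurable (fun h : E => ENNReal.ofReal (ρ ‖h‖)) volume :=
  hρ.ennreal_ofReal.comp_quasiMeasurePreserving (quasiMeasurePreserving_norm volume)

lemma lintegral_radialMeasure {ρ : ℝ → ℝ} (hρ : AEMeasurable ρ (volume.restrict (Ioi 0)))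
    (f : E → ℝ≥0∞) :
    ∫⁻ h, f h ∂radialMeasure E ρ = ∫⁻ h, ENNReal.ofReal (ρ ‖h‖) * f h := by
  rw [radialMeasure, lintegral_withDensity_eq_lintegral_mul_non_measurable₀ _
    (aemeasurable_ofReal_norm hρ) (by simp)]
  rfl

lemma radialEnergy_add_rpow_le {ρ : ℝ → ℝ} (hρ : AEMeasurable ρ (volume.restrict (Ioi 0)))
    {p : ℝ} (hp : 1 ≤ p) {f₁ f₂ : E → ℝ} (h₁ : AEStronglyMeasurable f₁ volume)
    (h₂ : AEStronglyMeasurable f₂ volume) :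
    radialEnergy ρ p (fun h => f₁ h + f₂ h) ^ (1 / p) ≤
      radialEnergy ρ p f₁ ^ (1 / p) + radialEnergy ρ p f₂ ^ (1 / p) := by
  have hp0 : 0 < p := by linarith
  have hm : ∀ {f : E → ℝ}, AEStronglyMeasurable f volume →
      AEMeasurable (fun h => ‖f h‖ₑ / ‖h‖ₑ) (radialMeasure E ρ) := fun hf =>
    (hf.enorm.div (by fun_prop)).mono_ac (withDensity_absolutelyContinuous _ _)
  simp only [radialEnergy, ← lintegral_radialMeasure hρ]
  refine le_trans (ENNReal.rpow_le_rpow (lintegral_mono fun h => ?_) (by positivity))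
    (ENNReal.lintegral_Lp_add_le (hm h₁) (hm h₂) hp)
  refine ENNReal.rpow_le_rpow ?_ hp0.le
  simp only [Pi.add_apply]
  rw [← ENNReal.add_div]
  gcongr
  exact enorm_add_le _ _

/-- Minkowski is used twice, for `f₁ + f₂` and for `f₁ = (f₁ + f₂) - f₂`, to squeeze the norm of the
sum between `Γ ^ (1 / p)` plus and minus a null sequence. -/
lemma tendsto_radialEnergy_add {ρ : ℕ → ℝ → ℝ}
    (hρ : ∀ n, AEMeasurable (ρ n) (volume.restrict (Ioi 0)))
    {p : ℝ} (hp : 1 ≤ p) {f₁ f₂ : E → ℝ} (h₁ : AEStronglyMeasurable f₁ volume)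
    (h₂ : AEStronglyMeasurable f₂ volume) {Γ : ℝ≥0∞} (hΓ : Γ ≠ ⊤)
    (hf₁ : ∀ n, radialEnergy (ρ n) p f₁ = Γ)
    (hf₂ : Tendsto (fun n => radialEnergy (ρ n) p f₂) atTop (𝓝 0)) :
    Tendsto (fun n => radialEnergy (ρ n) p (fun h => f₁ h + f₂ h)) atTop (𝓝 Γ) := by
  have hp0 : 0 < p := by linarith
  have h0 : Tendsto (fun n => radialEnergy (ρ n) p f₂ ^ (1 / p)) atTop (𝓝 0) := by
    have := hf₂.ennrpow_const (1 / p)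
    rwa [ENNReal.zero_rpow_of_pos (by positivity)] at this
  have hΓ' : Γ ^ (1 / p) ≠ ⊤ := by finiteness
  have hneg : ∀ n, radialEnergy (ρ n) p (fun h => -f₂ h) = radialEnergy (ρ n) p f₂ := fun n => by
    simp [radialEnergy]
  have key : Tendsto (fun n => radialEnergy (ρ n) p (fun h => f₁ h + f₂ h) ^ (1 / p)) atTop
      (𝓝 (Γ ^ (1 / p))) := by
    have hl : Tendsto (fun n => Γ ^ (1 / p) - radialEnergy (ρ n) p f₂ ^ (1 / p)) atTop
        (𝓝 (Γ ^ (1 / p))) := by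
      simpa using ENNReal.Tendsto.sub (tendsto_const_nhds (x := Γ ^ (1 / p))) h0 (Or.inl hΓ')
    have hu : Tendsto (fun n => Γ ^ (1 / p) + radialEnergy (ρ n) p f₂ ^ (1 / p)) atTop
        (𝓝 (Γ ^ (1 / p))) := by
      simpa using (tendsto_const_nhds (x := Γ ^ (1 / p))).add h0
    refine tendsto_of_tendsto_of_tendsto_of_le_of_le hl hu (fun n => ?_) fun n => ?_
    · have := radialEnergy_add_rpow_le (hρ n) hp (h₁.add h₂) h₂.neg
      simp only [Pi.add_apply, Pi.neg_apply, add_neg_cancel_right] at this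
      rw [hf₁] at this
      refine tsub_le_iff_right.2 (this.trans_eq ?_)
      exact congrArg₂ _ rfl (congrArg (· ^ (1 / p)) (hneg n))
    · have := radialEnergy_add_rpow_le (hρ n) hp h₁ h₂
      rwa [hf₁] at this
  have := key.ennrpow_const p
  simpa only [← ENNReal.rpow_mul, one_div_mul_cancel hp0.ne', ENNReal.rpow_one] using this

/-- The tangent line of `t ^ p` at `b`, via Bernoulli's inequality with `s = a / b - 1`. The
increment enters only to the first power. -/
lemma rpow_le_rpow_add_mul {a b p : ℝ} (ha : 0 ≤ a) (hb : 0 ≤ b) (hp : 1 ≤ p) :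
    b ^ p ≤ a ^ p + p * b ^ (p - 1) * |b - a| := by
  rcases hb.eq_or_lt with rfl | hb
  · rw [Real.zero_rpow (by linarith)]
    positivity
  · have h1 := one_add_mul_self_le_rpow_one_add (s := a / b - 1)
      (by linarith [div_nonneg ha hb.le]) hp
    rw [add_sub_cancel, Real.div_rpow ha hb.le, le_div_iff₀ (by positivity)] at h1
    have h2 : b ^ p = b ^ (p - 1) * b := by
      rw [← Real.rpow_add_one hb.ne', sub_add_cancel]
    have h3 : (1 + p * (a / b - 1)) * b ^ p = b ^ p - p * b ^ (p - 1) * (b - a) := by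
      rw [h2]; field_simp; ring
    have h4 : p * b ^ (p - 1) * (b - a) ≤ p * b ^ (p - 1) * |b - a| := by
      gcongr
      exact le_abs_self _
    linarith

/-- With `b = |⟪c, h⟫| / ‖h‖ ≤ ‖c‖` in the tangent inequality, the perturbation `f` is measured with
exponent one. Hence the lower bound needs neither monotone mollifiers nor an upper bound on `p`. -/
lemma radialEnergy_inner_le {ρ : ℝ → ℝ} (hρ : AEMeasurable ρ (volume.restrict (Ioi 0))) {p : ℝ}
    (hp : 1 ≤ p) (c : E) {f : E → ℝ} (hf : AEStronglyMeasurable f volume) :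
    radialEnergy ρ p (fun h : E => inner ℝ c h) ≤
      radialEnergy ρ p (fun h => inner ℝ c h + f h) +
        ENNReal.ofReal (p * ‖c‖ ^ (p - 1)) * radialEnergy ρ 1 f := by
  have hp0 : 0 < p := by linarith
  have hm : AEMeasurable (fun h => ENNReal.ofReal (ρ ‖h‖) * (‖f h‖ₑ / ‖h‖ₑ) ^ (1 : ℝ)) volume :=
    (aemeasurable_ofReal_norm hρ).mul ((hf.enorm.div (by fun_prop)).pow_const _)
  rw [radialEnergy, radialEnergy, radialEnergy, ← lintegral_const_mul'' _ hm,
    ← lintegral_add_right' _ (hm.const_mul _)]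
  refine lintegral_mono_ae ?_
  filter_upwards [measure_eq_zero_iff_ae_notMem.1 (measure_singleton (μ := volume) (0 : E))] with h hh
  have hh0 : 0 < ‖h‖ := by simpa using hh
  rw [mul_left_comm, ← mul_add]
  gcongr
  rw [ENNReal.rpow_one]
  have hd : ∀ s : ℝ, ‖s‖ₑ / ‖h‖ₑ = ENNReal.ofReal (|s| / ‖h‖) := fun s => by
    rw [ENNReal.ofReal_div_of_pos hh0, ofReal_norm, ← Real.norm_eq_abs, ofReal_norm]
  rw [hd, hd, hd, ENNReal.ofReal_rpow_of_nonneg (by positivity) hp0.le,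
    ENNReal.ofReal_rpow_of_nonneg (by positivity) hp0.le, ← ENNReal.ofReal_mul (by positivity),
    ← ENNReal.ofReal_add (by positivity) (by positivity)]
  refine ENNReal.ofReal_le_ofReal ((rpow_le_rpow_add_mul (a := |inner ℝ c h + f h| / ‖h‖)
    (by positivity) (by positivity) hp).trans ?_)
  gcongr
  · rw [div_le_iff₀ hh0]
    exact abs_real_inner_le_norm c h
  · rw [← sub_div, abs_div, abs_of_pos hh0]
    refine div_le_div_of_nonneg_right ?_ hh0.le
    have h1 := abs_abs_sub_abs_le (inner ℝ c h : ℝ) (inner ℝ c h + f h)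
    rwa [sub_add_cancel_left, abs_neg] at h1

lemma le_liminf_radialEnergy_add {ρ : ℕ → ℝ → ℝ}
    (hρ : ∀ n, AEMeasurable (ρ n) (volume.restrict (Ioi 0)))
    {p : ℝ} (hp : 1 ≤ p) (c : E) {f : E → ℝ} (hf : AEStronglyMeasurable f volume) {Γ : ℝ≥0∞}
    (hΓ : Γ ≠ ⊤) (hc : ∀ n, radialEnergy (ρ n) p (fun h : E => inner ℝ c h) = Γ)
    (hf0 : Tendsto (fun n => radialEnergy (ρ n) 1 f) atTop (𝓝 0)) :
    Γ ≤ liminf (fun n => radialEnergy (ρ n) p (fun h => inner ℝ c h + f h)) atTop := by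
  have h1 : Tendsto (fun n => Γ - ENNReal.ofReal (p * ‖c‖ ^ (p - 1)) * radialEnergy (ρ n) 1 f)
      atTop (𝓝 Γ) := by
    have := ENNReal.Tendsto.const_mul (a := ENNReal.ofReal (p * ‖c‖ ^ (p - 1))) hf0
      (Or.inr ENNReal.ofReal_ne_top)
    rw [mul_zero] at this
    simpa using ENNReal.Tendsto.sub (tendsto_const_nhds (x := Γ)) this (Or.inl hΓ)
  rw [← h1.liminf_eq]
  refine liminf_le_liminf (Eventually.of_forall fun n => tsub_le_iff_right.2 ?_)
  rw [← hc n]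
  exact radialEnergy_inner_le (hρ n) hp c hf

end WeightedEnergy

/-! ### The energy of the remainder tends to zero. -/

section Vanishing

open Metric Module

variable {E : Type*} [NormedAddCommGroup E] [InnerProductSpace ℝ E] [FiniteDimensional ℝ E]
  [Nontrivial E] [MeasureSpace E] [BorelSpace E] [(volume : Measure E).IsAddHaarMeasure]

/-- For `p = 1` the energy of the remainder vanishes in the limit for all radial mollifiers. -/
lemma IsGoodPoint.tendsto_radialEnergy_one {ρ : ℕ → ℝ → ℝ}
    (hρ : IsRadialMollifier (finrank ℝ E) ρ) {u : E → ℝ} {g : E → E}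
    (h : HasWeakGradientLoc u g) {x : E} (hx : IsGoodPoint u g x) :
    Tendsto (fun n => radialEnergy (ρ n) 1 (taylorRemainder u x (g x))) atTop (𝓝 0) := by
  have hm := AEStronglyMeasurable.taylorRemainder h.locallyIntegrable.aestronglyMeasurable x (g x)
  simp only [fun n => radialEnergy_polar (hρ.aemeasurable n) (hρ.nonneg n) 1 hm, ENNReal.rpow_one]
  have hS := h.ae_lintegral_sphere_taylorRemainder_le hx.tendsto_mollify
  set C : ℝ≥0∞ := finrank ℝ E * 4 ^ finrank ℝ E with hC
  have hC0 : C ≠ 0 := by simp [hC, finrank_pos.ne']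
  have hCt : C ≠ ⊤ := by finiteness
  have key : ∀ R K, OscillationBound g x (2 * R) K → ∀ᵐ r ∂volume.restrict (Ioi (0 : ℝ)), r ≤ R →
      ∫⁻ σ, ‖taylorRemainder u x (g x) (r • ((σ : sphere (0 : E) 1) : E))‖ₑ / ENNReal.ofReal r
        ∂(volume : Measure E).toSphere ≤ C * K := by
    intro R K hK
    filter_upwards [hS, ae_restrict_mem measurableSet_Ioi] with r hr hr0 hrR
    have hr' : ENNReal.ofReal r ≠ 0 := by simpa using hr0
    simp only [div_eq_mul_inv]
    rw [lintegral_mul_const' _ _ (ENNReal.inv_ne_top.2 hr'), ← div_eq_mul_inv]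
    refine ENNReal.div_le_of_le_mul ((hr K (hK.mono (by linarith))).trans_eq ?_)
    rw [hC]; ring
  refine hρ.tendsto_lintegral_mul (fun η hη => ?_) ?_
  · obtain ⟨δ, hδ, hδ'⟩ := hx.small (η / C) (ENNReal.div_pos hη.ne' hCt)
    refine ⟨δ / 2, by positivity, ?_⟩
    filter_upwards [key (δ / 2) (η / C) (by convert hδ' using 1; ring)] with r hr hr'
    exact (hr hr').trans_eq (ENNReal.mul_div_cancel hC0 hCt)
  · obtain ⟨K, hK, hK'⟩ := hx.exists_bound 2
    exact ⟨C * K, by finiteness, key 1 K (by simpa using hK')⟩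

/-- Up to the Sobolev exponent, the energy of the remainder vanishes in the limit for
non-increasing radial mollifiers. -/
lemma IsGoodPoint.tendsto_radialEnergy_of_antitoneOn {ρ : ℕ → ℝ → ℝ}
    (hρ : IsRadialMollifier (finrank ℝ E) ρ) (ha : ∀ n, AntitoneOn (ρ n) (Ioi 0)) {q : NNReal}
    (hq : NNReal.HolderConjugate (finrank ℝ E) q) {p : ℝ} (hp : 1 ≤ p) (hpq : p ≤ q)
    {u : E → ℝ} {g : E → E} (h : HasWeakGradientLoc u g) {x : E} (hx : IsGoodPoint u g x) :
    Tendsto (fun n => radialEnergy (ρ n) p (taylorRemainder u x (g x))) atTop (𝓝 0) := by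
  obtain ⟨C, hC, hS⟩ := HasWeakGradientLoc.exists_lintegral_rpow_taylorRemainder_le (E := E)
    hq hp hpq
  set d := finrank ℝ E with hd
  have hd0 : 0 < d := finrank_pos
  have hp0 : 0 < p := by linarith
  set v := taylorRemainder u x (g x) with hv
  have hm : AEStronglyMeasurable v volume :=
    AEStronglyMeasurable.taylorRemainder h.locallyIntegrable.aestronglyMeasurable x (g x)
  have hfm : AEMeasurable (fun y => ‖v y‖ₑ ^ p) volume := hm.enorm.pow_const p
  obtain ⟨K₁, hK₁, hK₁'⟩ := hx.exists_bound 4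
  have hI : ∫⁻ y in closedBall 0 1, ‖v y‖ₑ ^ p ≠ ⊤ := by
    refine ne_top_of_le_ne_top ?_ (hS h hx.tendsto_mollify one_pos (K := K₁) (by simpa using hK₁'))
    finiteness
  -- Near the origin the weight `ρ r * r ^ (-p)` is decreasing. Against the comparison density `(d +
  -- p) r ^ (d + p - 1)` it leaves `(d + p) ρ r r ^ (d - 1)`, of mass at most `d + p`.
  have hinner : ∀ (n : ℕ) (δ : ℝ) (η : ℝ≥0∞), OscillationBound g x (4 * δ) η →
      ∫⁻ y in closedBall 0 δ, ENNReal.ofReal (ρ n ‖y‖ * ‖y‖ ^ (-p)) * ‖v y‖ₑ ^ p ≤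
        C * η ^ p * ENNReal.ofReal (d + p) := by
    intro n δ η hη
    have hanti : AntitoneOn (fun r => ρ n r * r ^ (-p)) (Ioi 0) := by
      intro s hs t ht hst
      have hs0 : 0 < s := hs
      exact mul_le_mul (ha n hs ht hst)
        (Real.rpow_le_rpow_of_nonpos hs0 hst (by linarith)) (Real.rpow_nonneg (le_of_lt ht) _)
        (hρ.nonneg n s hs)
    refine (setLIntegral_closedBall_antitoneOn_mul_le volume hfm (K := C * η ^ p) (a := d + p)
      (R := δ) (by positivity) (fun s hs hsδ => ?_) hanti fun r hr =>
        mul_nonneg (hρ.nonneg n r hr) (Real.rpow_nonneg hr.le _)).trans ?_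
    · exact hS h hx.tendsto_mollify hs (hη.mono (by linarith))
    · gcongr
      calc _ = ∫⁻ r in Ioc 0 δ, ENNReal.ofReal (d + p) *
            ENNReal.ofReal (ρ n r * r ^ (d - 1)) := by
            refine setLIntegral_congr_fun measurableSet_Ioc fun r hr => ?_
            have hr0 : 0 < r := hr.1
            rw [← ENNReal.ofReal_mul (by positivity), ← ENNReal.ofReal_mul (by positivity)]
            congr 1
            rw [show (d : ℝ) + p - 1 = ((d - 1 : ℕ) : ℝ) + p by
                rw [Nat.cast_sub hd0]; push_cast; ring,
              Real.rpow_add hr0, Real.rpow_natCast, Real.rpow_neg hr0.le]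
            field_simp
        _ ≤ ENNReal.ofReal (d + p) * 1 := by
            rw [lintegral_const_mul' _ _ ENNReal.ofReal_ne_top, ← hρ.lintegral_eq_one n]
            gcongr
            exact Ioc_subset_Ioi_self
        _ = _ := mul_one _
  -- Away from the origin the weight is at most its value at `δ`, where `ρ n δ` tends to zero; only
  -- the unit ball counts.
  have houter : ∀ (n : ℕ) (δ : ℝ), 0 < δ →
      ∫⁻ y in (closedBall 0 δ)ᶜ, ENNReal.ofReal (ρ n ‖y‖ * ‖y‖ ^ (-p)) * ‖v y‖ₑ ^ p ≤
        ENNReal.ofReal (ρ n δ) *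
          (ENNReal.ofReal (δ ^ (-p)) * ∫⁻ y in closedBall 0 1, ‖v y‖ₑ ^ p) := by
    intro n δ hδ
    rw [← lintegral_const_mul' _ _ ENNReal.ofReal_ne_top,
      ← lintegral_const_mul' _ _ ENNReal.ofReal_ne_top,
      ← lintegral_indicator measurableSet_closedBall.compl,
      ← lintegral_indicator measurableSet_closedBall]
    refine lintegral_mono fun y => ?_
    by_cases hy : y ∈ (closedBall (0 : E) δ)ᶜ
    · rw [indicator_of_mem hy]
      have hyδ : δ < ‖y‖ := by simpa using hy
      have hy0 : 0 < ‖y‖ := hδ.trans hyδ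
      by_cases hy1 : y ∈ closedBall (0 : E) 1
      · rw [indicator_of_mem hy1, ← mul_assoc, ← ENNReal.ofReal_mul (hρ.nonneg n δ hδ)]
        gcongr ENNReal.ofReal ?_ * _
        exact mul_le_mul (ha n hδ hy0 hyδ.le)
          (Real.rpow_le_rpow_of_nonpos hδ hyδ.le (by linarith)) (Real.rpow_nonneg hy0.le _)
          (hρ.nonneg n δ hδ)
      · have hy1' : 1 < ‖y‖ := by simpa using hy1
        simp [hρ.eq_zero n _ hy1']
    · rw [indicator_of_notMem hy]
      exact zero_le
  have hrw : ∀ n, radialEnergy (ρ n) p v =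
      ∫⁻ y, ENNReal.ofReal (ρ n ‖y‖ * ‖y‖ ^ (-p)) * ‖v y‖ₑ ^ p := by
    intro n
    refine lintegral_congr_ae ?_
    filter_upwards [measure_eq_zero_iff_ae_notMem.1 (measure_singleton (μ := volume) (0 : E))]
      with y hy
    have hy0 : 0 < ‖y‖ := by simpa using hy
    rw [ENNReal.div_rpow_of_nonneg _ _ hp0.le, ENNReal.ofReal_mul (hρ.nonneg n _ hy0),
      ENNReal.div_eq_inv_mul, mul_assoc, ← ENNReal.rpow_neg, ← ofReal_norm,
      ENNReal.ofReal_rpow_of_pos hy0]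
  rw [ENNReal.tendsto_nhds_zero]
  intro ε hε
  obtain ⟨η, hη0, hη⟩ : ∃ η : ℝ≥0∞, 0 < η ∧ C * η ^ p * ENNReal.ofReal (d + p) ≤ ε / 2 := by
    have h1 : Tendsto (fun η : ℝ≥0∞ => C * η ^ p * ENNReal.ofReal (d + p)) (𝓝[>] 0) (𝓝 0) := by
      have h2 : Tendsto (fun η : ℝ≥0∞ => η ^ p) (𝓝[>] 0) (𝓝 0) := by
        have := (ENNReal.continuous_rpow_const (y := p)).tendsto 0
        rw [ENNReal.zero_rpow_of_pos hp0] at this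
        exact this.mono_left nhdsWithin_le_nhds
      have h3 := ENNReal.Tendsto.const_mul (a := C) h2 (Or.inr hC)
      rw [mul_zero] at h3
      have h4 := ENNReal.Tendsto.mul_const (b := ENNReal.ofReal (d + p)) h3
        (Or.inr ENNReal.ofReal_ne_top)
      rwa [zero_mul] at h4
    obtain ⟨η, h5, h6⟩ := ((h1.eventually (ge_mem_nhds (ENNReal.half_pos hε.ne'))).and
      self_mem_nhdsWithin).exists
    exact ⟨η, h6, h5⟩
  obtain ⟨δ, hδ, hδ'⟩ := hx.small η hη0
  have hδ4 : 0 < δ / 4 := by positivity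
  have ht : Tendsto (fun n => ENNReal.ofReal (ρ n (δ / 4)) *
      (ENNReal.ofReal ((δ / 4) ^ (-p)) * ∫⁻ y in closedBall 0 1, ‖v y‖ₑ ^ p)) atTop (𝓝 0) := by
    have := ENNReal.Tendsto.mul_const
      (b := ENNReal.ofReal ((δ / 4) ^ (-p)) * ∫⁻ y in closedBall 0 1, ‖v y‖ₑ ^ p)
      (hρ.tendsto_ofReal_of_antitoneOn hd0 ha hδ4)
      (Or.inr (ENNReal.mul_ne_top ENNReal.ofReal_ne_top hI))
    rwa [zero_mul] at this
  filter_upwards [ht.eventually (ge_mem_nhds (ENNReal.half_pos hε.ne'))] with n hn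
  rw [hrw, ← lintegral_add_compl _ (measurableSet_closedBall (x := (0 : E)) (ε := δ / 4)),
    ← ENNReal.add_halves ε]
  exact add_le_add ((hinner n (δ / 4) η (by convert hδ' using 1; ring)).trans hη)
    ((houter n (δ / 4) hδ4).trans hn)

end Vanishing

/-! ### Surface measure: the two-point sphere and independence of the unit vector. -/

section SphereMoment

open Metric Module

-- The cone over `σ` is an open interval of length one, so the surface measure on `{-1, 1}` is
-- counting measure.
open scoped Pointwise in
lemma toSphere_real_singleton (σ : sphere (0 : ℝ) 1) :
    (volume : Measure ℝ).toSphere {σ} = 1 := by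
  have hσ : |(σ : ℝ)| = 1 := mem_sphere_zero_iff_norm.1 σ.2
  rw [Measure.toSphere_apply' _ (measurableSet_singleton σ), image_singleton]
  have h1 : (Ioo (0 : ℝ) 1 • ({(σ : ℝ)} : Set ℝ)) = (σ : ℝ) • Ioo (0 : ℝ) 1 := by
    ext y
    simp [mem_smul_set, mul_comm]
  rw [h1, Measure.addHaar_smul]
  simp [hσ]

/-- Atoms of unit mass turn an integral bound on the sphere into a pointwise bound; this is why
every `p` is allowed in dimension one. -/
lemma le_lintegral_toSphere_real (f : sphere (0 : ℝ) 1 → ℝ≥0∞) (σ : sphere (0 : ℝ) 1) :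
    f σ ≤ ∫⁻ σ, f σ ∂(volume : Measure ℝ).toSphere := by
  calc f σ = ∫⁻ τ in {σ}, f τ ∂(volume : Measure ℝ).toSphere := by
        rw [lintegral_singleton, toSphere_real_singleton, mul_one]
    _ ≤ _ := setLIntegral_le_lintegral _ _

/-- In dimension one the energy of the remainder vanishes in the limit for all exponents. -/
lemma IsGoodPoint.tendsto_radialEnergy_real {ρ : ℕ → ℝ → ℝ}
    (hρ : IsRadialMollifier 1 ρ) {u u' : ℝ → ℝ} (h : HasWeakGradientLoc u u') {x : ℝ}
    (hx : IsGoodPoint u u' x) {p : ℝ} (hp : 0 < p) :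
    Tendsto (fun n => radialEnergy (ρ n) p (taylorRemainder u x (u' x))) atTop (𝓝 0) := by
  have hm := AEStronglyMeasurable.taylorRemainder h.locallyIntegrable.aestronglyMeasurable x (u' x)
  simp only [fun n => radialEnergy_polar (hρ.aemeasurable n) (hρ.nonneg n) p hm]
  rw [finrank_self]
  have hS := h.ae_lintegral_sphere_taylorRemainder_le hx.tendsto_mollify
  simp only [finrank_self, Nat.cast_one, one_mul, pow_one] at hS
  set T := (volume : Measure ℝ).toSphere univ with hT
  have hTt : T ≠ ⊤ := measure_ne_top _ _
  have key : ∀ R K, OscillationBound u' x (2 * R) K → ∀ᵐ r ∂volume.restrict (Ioi (0 : ℝ)), r ≤ R →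
      ∫⁻ σ, (‖taylorRemainder u x (u' x) (r • ((σ : sphere (0 : ℝ) 1) : ℝ))‖ₑ /
        ENNReal.ofReal r) ^ p ∂(volume : Measure ℝ).toSphere ≤ (4 * K) ^ p * T := by
    intro R K hK
    filter_upwards [hS, ae_restrict_mem measurableSet_Ioi] with r hr hr0 hrR
    rw [hT, ← lintegral_const]
    refine lintegral_mono fun σ => ENNReal.rpow_le_rpow ?_ hp.le
    refine ENNReal.div_le_of_le_mul (le_trans ?_ (hr K (hK.mono (by linarith))))
    exact le_lintegral_toSphere_real
      (fun σ => ‖taylorRemainder u x (u' x) (r • (σ : ℝ))‖ₑ) σ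
  refine hρ.tendsto_lintegral_mul (fun η hη => ?_) ?_
  · have h1 : Tendsto (fun K : ℝ≥0∞ => (4 * K) ^ p * T) (𝓝[>] 0) (𝓝 0) := by
      have h2 : Tendsto (fun K : ℝ≥0∞ => 4 * K) (𝓝[>] 0) (𝓝 0) := by
        have := ENNReal.Tendsto.const_mul (a := 4) (tendsto_id (x := 𝓝 (0 : ℝ≥0∞)))
          (Or.inr (by simp))
        rw [mul_zero] at this
        exact this.mono_left nhdsWithin_le_nhds
      have h3 := h2.ennrpow_const p
      rw [ENNReal.zero_rpow_of_pos hp] at h3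
      have h4 := ENNReal.Tendsto.mul_const (b := T) h3 (Or.inr hTt)
      rwa [zero_mul] at h4
    obtain ⟨K, h5, h6⟩ := ((h1.eventually (ge_mem_nhds hη)).and self_mem_nhdsWithin).exists
    obtain ⟨δ, hδ, hδ'⟩ := hx.small K h6
    refine ⟨δ / 2, by positivity, ?_⟩
    filter_upwards [key (δ / 2) K (by convert hδ' using 1; ring)] with r hr hr'
    exact (hr hr').trans h5
  · obtain ⟨K, hK, hK'⟩ := hx.exists_bound 2
    exact ⟨(4 * K) ^ p * T, by finiteness, key 1 K (by simpa using hK')⟩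

section

variable {E : Type*} [NormedAddCommGroup E] [InnerProductSpace ℝ E] [FiniteDimensional ℝ E]
  [MeasureSpace E] [BorelSpace E] [(volume : Measure E).IsAddHaarMeasure]

lemma ofReal_sphereMoment {p : ℝ} (hp : 0 ≤ p) (e : E) :
    ENNReal.ofReal (sphereMoment p e) =
      ∫⁻ σ, ‖(inner ℝ e ((σ : sphere (0 : E) 1) : E) : ℝ)‖ₑ ^ p
        ∂(volume : Measure E).toSphere := by
  have hc : Continuous fun σ : sphere (0 : E) 1 => |inner ℝ (σ : E) e| ^ p :=
    (by fun_prop : Continuous fun σ : sphere (0 : E) 1 => |inner ℝ (σ : E) e|).rpow_const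
      fun _ => Or.inr hp
  rw [sphereMoment, ofReal_integral_eq_lintegral_ofReal
    (hc.integrable_of_hasCompactSupport (HasCompactSupport.of_compactSpace _))
    (ae_of_all _ fun _ => by positivity)]
  refine lintegral_congr fun σ => ?_
  rw [← ENNReal.ofReal_rpow_of_nonneg (abs_nonneg _) hp, ← Real.norm_eq_abs, ofReal_norm,
    real_inner_comm]

omit [FiniteDimensional ℝ E] [BorelSpace E] [(volume : Measure E).IsAddHaarMeasure] in
lemma lintegral_toSphere_inner_smul {p : ℝ} (hp : 0 ≤ p) (t : ℝ) (e : E) :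
    ∫⁻ σ, ‖(inner ℝ (t • e) ((σ : sphere (0 : E) 1) : E) : ℝ)‖ₑ ^ p
        ∂(volume : Measure E).toSphere =
      ENNReal.ofReal (|t| ^ p) * ∫⁻ σ, ‖(inner ℝ e ((σ : sphere (0 : E) 1) : E) : ℝ)‖ₑ ^ p
        ∂(volume : Measure E).toSphere := by
  rw [← lintegral_const_mul' _ _ ENNReal.ofReal_ne_top]
  refine lintegral_congr fun σ => ?_
  rw [real_inner_smul_left, enorm_mul, ENNReal.mul_rpow_of_nonneg _ _ hp,
    ← ENNReal.ofReal_rpow_of_nonneg (abs_nonneg _) hp, ← Real.norm_eq_abs, ofReal_norm]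

/-- By homogeneity the radial factor is `∫_0^1 r ^ (d - 1 + p) dr`. The passage to the ball makes
isometry invariance of volume available for spherical integrals. -/
lemma lintegral_closedBall_inner_rpow [Nontrivial E] {p : ℝ} (hp : 0 ≤ p) (e : E) :
    ∫⁻ y in closedBall (0 : E) 1, ‖(inner ℝ e y : ℝ)‖ₑ ^ p =
      ENNReal.ofReal (1 / (finrank ℝ E + p)) *
        ∫⁻ σ, ‖(inner ℝ e ((σ : sphere (0 : E) 1) : E) : ℝ)‖ₑ ^ p
          ∂(volume : Measure E).toSphere := by
  have hd0 : 0 < finrank ℝ E := finrank_pos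
  have ha : 0 < (finrank ℝ E : ℝ) + p := by positivity
  rw [setLIntegral_closedBall_polar volume (by fun_prop)]
  set Γ := ∫⁻ σ, ‖(inner ℝ e ((σ : sphere (0 : E) 1) : E) : ℝ)‖ₑ ^ p
          ∂(volume : Measure E).toSphere with hΓ
  have h1 := setLIntegral_Ioc_rpow_sub_one ha zero_le_one
  calc _ = ∫⁻ r in Ioc (0 : ℝ) 1, ENNReal.ofReal (1 / (finrank ℝ E + p)) * ENNReal.ofReal
        ((finrank ℝ E + p) * r ^ ((finrank ℝ E : ℝ) + p - 1)) * Γ := by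
        refine setLIntegral_congr_fun measurableSet_Ioc fun r hr => ?_
        have hr0 : 0 < r := hr.1
        simp only [inner_smul_right, enorm_mul, ENNReal.mul_rpow_of_nonneg _ _ hp]
        rw [lintegral_const_mul' _ _ (by finiteness), ← mul_assoc, Real.enorm_of_nonneg hr0.le,
          ENNReal.ofReal_rpow_of_pos hr0, ← ENNReal.ofReal_mul (by positivity),
          ← ENNReal.ofReal_mul (by positivity)]
        congr 2
        rw [show (finrank ℝ E : ℝ) + p - 1 = ((finrank ℝ E - 1 : ℕ) : ℝ) + p by
            rw [Nat.cast_sub hd0]; push_cast; ring,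
          Real.rpow_add hr0, Real.rpow_natCast]
        field_simp
    _ = _ := by
        rw [lintegral_mul_const _ (by fun_prop), lintegral_const_mul' _ _ ENNReal.ofReal_ne_top, h1]
        simp

end

lemma lintegral_toSphere_inner_eq_of_norm_eq {E : Type*} [NormedAddCommGroup E]
    [InnerProductSpace ℝ E] [FiniteDimensional ℝ E] [MeasurableSpace E] [BorelSpace E]
    [Nontrivial E] {p : ℝ} (hp : 0 ≤ p) {e e' : E} (he : ‖e‖ = ‖e'‖) :
    ∫⁻ σ, ‖(inner ℝ e ((σ : sphere (0 : E) 1) : E) : ℝ)‖ₑ ^ p ∂(volume : Measure E).toSphere =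
      ∫⁻ σ, ‖(inner ℝ e' ((σ : sphere (0 : E) 1) : E) : ℝ)‖ₑ ^ p
        ∂(volume : Measure E).toSphere := by
  have hd0 : 0 < finrank ℝ E := finrank_pos
  have ha : 0 < (finrank ℝ E : ℝ) + p := by positivity
  have h1 : ENNReal.ofReal (1 / (finrank ℝ E + p)) ≠ 0 := by simpa using ha
  refine (ENNReal.mul_right_inj h1 ENNReal.ofReal_ne_top).1 ?_
  rw [← lintegral_closedBall_inner_rpow hp, ← lintegral_closedBall_inner_rpow hp]
  -- The reflection in the hyperplane orthogonal to `e - e'` maps `e` to `e'` and preserves the ball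
  -- and its volume.
  set A := (ℝ ∙ (e - e'))ᗮ.reflection
  have hA : A e = e' := Submodule.reflection_sub he
  have hpre : A ⁻¹' closedBall 0 1 = closedBall 0 1 := by
    ext y; simp
  conv_rhs => rw [← (A.measurePreserving.restrict_preimage
    measurableSet_closedBall).lintegral_comp_emb A.toHomeomorph.measurableEmbedding, hpre]
  refine lintegral_congr fun y => ?_
  rw [← hA, A.inner_map_map]

end SphereMoment

/-! ### The almost everywhere limits and the lower bound. -/

section Limits

open Metric Module

theorem HasWeakGradientLoc.ae_tendsto_nonlocalEnergy_real {ρ : ℕ → ℝ → ℝ}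
    (hρ : IsRadialMollifier 1 ρ) {u u' : ℝ → ℝ} (h : HasWeakGradientLoc u u') {p : ℝ}
    (hp : 1 < p) {e : ℝ} (he : ‖e‖ = 1) :
    ∀ᵐ x : ℝ, Tendsto (fun n => nonlocalEnergy (ρ n) p u x) atTop
      (𝓝 (ENNReal.ofReal (sphereMoment p e * |u' x| ^ p))) := by
  have hp0 : 0 ≤ p := by linarith
  filter_upwards [h.ae_isGoodPoint] with x hx
  have hm := AEStronglyMeasurable.taylorRemainder h.locallyIntegrable.aestronglyMeasurable x (u' x)
  have hρ' : IsRadialMollifier (finrank ℝ ℝ) ρ := by rwa [finrank_self]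
  have hΓ : ENNReal.ofReal (sphereMoment p e * |u' x| ^ p) =
      ∫⁻ σ, ‖(inner ℝ (u' x) ((σ : sphere (0 : ℝ) 1) : ℝ) : ℝ)‖ₑ ^ p
        ∂(volume : Measure ℝ).toSphere := by
    have h1 : u' x = (u' x * e) • e := by
      have : e * e = 1 := by
        rw [← abs_mul_abs_self, ← Real.norm_eq_abs, he, one_mul]
      rw [smul_eq_mul, mul_assoc, this, mul_one]
    have h2 : |u' x * e| = |u' x| := by rw [abs_mul, ← Real.norm_eq_abs e, he, mul_one]
    conv_rhs => rw [h1]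
    rw [lintegral_toSphere_inner_smul hp0, h2, ← ofReal_sphereMoment hp0, mul_comm,
      ENNReal.ofReal_mul (by positivity)]
  rw [hΓ]
  simp only [fun n => nonlocalEnergy_eq_radialEnergy (hρ.nonneg n) hp0 u x (u' x)]
  exact tendsto_radialEnergy_add hρ.aemeasurable hp.le (by fun_prop) hm
    (lintegral_enorm_inner_rpow_ne_top hp0 _) (fun n => radialEnergy_inner hρ' n p _)
    (hx.tendsto_radialEnergy_real hρ h (by linarith))

variable {E : Type*} [NormedAddCommGroup E] [InnerProductSpace ℝ E] [FiniteDimensional ℝ E]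
  [MeasurableSpace E] [BorelSpace E] [Nontrivial E]

lemma ofReal_sphereMoment_mul_rpow {p : ℝ} (hp : 0 ≤ p) {e : E} (he : ‖e‖ = 1) (c : E) :
    ENNReal.ofReal (sphereMoment p e * ‖c‖ ^ p) =
      ∫⁻ σ, ‖(inner ℝ c ((σ : sphere (0 : E) 1) : E) : ℝ)‖ₑ ^ p
        ∂(volume : Measure E).toSphere := by
  rw [lintegral_toSphere_inner_eq_of_norm_eq hp (e := c) (e' := ‖c‖ • e) (by simp [norm_smul, he]),
    lintegral_toSphere_inner_smul hp, ← ofReal_sphereMoment hp, mul_comm,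
    ENNReal.ofReal_mul (by positivity), abs_norm]

theorem HasWeakGradientLoc.ae_tendsto_nonlocalEnergy_of_antitoneOn {ρ : ℕ → ℝ → ℝ}
    (hρ : IsRadialMollifier (finrank ℝ E) ρ) (ha : ∀ n, AntitoneOn (ρ n) (Ioi 0))
    (hd : 2 ≤ finrank ℝ E) {u : E → ℝ} {g : E → E} (h : HasWeakGradientLoc u g) {p : ℝ}
    (hp : 1 ≤ p) (hpd : p ≤ (finrank ℝ E : ℝ) / ((finrank ℝ E : ℝ) - 1)) {e : E}
    (he : ‖e‖ = 1) :
    ∀ᵐ x, Tendsto (fun n => nonlocalEnergy (ρ n) p u x) atTop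
      (𝓝 (ENNReal.ofReal (sphereMoment p e * ‖g x‖ ^ p))) := by
  have hp0 : 0 ≤ p := by linarith
  have hd1 : (1 : NNReal) < (finrank ℝ E : NNReal) := by exact_mod_cast hd
  have hq : NNReal.HolderConjugate (finrank ℝ E) (NNReal.conjExponent (finrank ℝ E)) :=
    .conjExponent hd1
  have hpq : p ≤ NNReal.conjExponent (finrank ℝ E) := by
    rwa [hq.coe.conjugate_eq]
  filter_upwards [h.ae_isGoodPoint] with x hx
  have hm := AEStronglyMeasurable.taylorRemainder h.locallyIntegrable.aestronglyMeasurable x (g x)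
  rw [ofReal_sphereMoment_mul_rpow hp0 he]
  simp only [fun n => nonlocalEnergy_eq_radialEnergy (hρ.nonneg n) hp0 u x (g x)]
  exact tendsto_radialEnergy_add hρ.aemeasurable hp (by fun_prop) hm
    (lintegral_enorm_inner_rpow_ne_top hp0 _) (fun n => radialEnergy_inner hρ n p _)
    (hx.tendsto_radialEnergy_of_antitoneOn hρ ha hq hp hpq h)

theorem HasWeakGradientLoc.ae_le_liminf_nonlocalEnergy {ρ : ℕ → ℝ → ℝ}
    (hρ : IsRadialMollifier (finrank ℝ E) ρ) {u : E → ℝ} {g : E → E}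
    (h : HasWeakGradientLoc u g) {p : ℝ} (hp : 1 ≤ p) {e : E} (he : ‖e‖ = 1) :
    ∀ᵐ x, ENNReal.ofReal (sphereMoment p e * ‖g x‖ ^ p) ≤
      liminf (fun n => nonlocalEnergy (ρ n) p u x) atTop := by
  have hp0 : 0 ≤ p := by linarith
  filter_upwards [h.ae_isGoodPoint] with x hx
  have hm := AEStronglyMeasurable.taylorRemainder h.locallyIntegrable.aestronglyMeasurable x (g x)
  rw [ofReal_sphereMoment_mul_rpow hp0 he]
  simp only [fun n => nonlocalEnergy_eq_radialEnergy (hρ.nonneg n) hp0 u x (g x)]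
  exact le_liminf_radialEnergy_add hρ.aemeasurable hp _ hm
    (lintegral_enorm_inner_rpow_ne_top hp0 _) (fun n => radialEnergy_inner hρ n p _)
    (hx.tendsto_radialEnergy_one hρ h)

end Limits

/-! ### A power singularity with logarithmic damping. -/

section LogSingular

/-- Squaring the positive part removes the corner, so the truncated profile stays differentiable. -/
lemma hasDerivAt_max_zero_sq (x : ℝ) :
    HasDerivAt (fun t : ℝ => max t 0 ^ 2) (2 * max x 0) x := by
  rcases lt_trichotomy x 0 with hx | rfl | hx
  · rw [max_eq_right hx.le, mul_zero]
    refine (hasDerivAt_const x (0 : ℝ)).congr_of_eventuallyEq ?_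
    filter_upwards [Iio_mem_nhds hx] with t ht
    simp [max_eq_right (mem_Iio.1 ht).le]
  · rw [hasDerivAt_iff_tendsto_slope_zero]
    have h0 : Tendsto (fun t : ℝ => |t|) (𝓝[≠] 0) (𝓝 0) := by
      have : Tendsto (fun t : ℝ => |t|) (𝓝 0) (𝓝 |0|) := continuous_abs.tendsto 0
      rw [abs_zero] at this
      exact this.mono_left nhdsWithin_le_nhds
    simp only [zero_add, max_self, mul_zero, smul_eq_mul]
    refine squeeze_zero_norm (fun t => ?_) h0
    rcases le_or_gt t 0 with ht | ht
    · simp [max_eq_right ht]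
    · rw [max_eq_left ht.le]
      simp only [ne_eq, OfNat.ofNat_ne_zero, not_false_eq_true, zero_pow, sub_zero]
      rw [sq, ← mul_assoc, inv_mul_cancel₀ ht.ne', one_mul, Real.norm_eq_abs]
  · rw [max_eq_left hx.le]
    have h := hasDerivAt_pow 2 x
    simp only [Nat.cast_ofNat, Nat.add_one_sub_one, pow_one] at h
    refine h.congr_of_eventuallyEq ?_
    filter_upwards [Ioi_mem_nhds hx] with t ht
    rw [max_eq_left (mem_Ioi.1 ht).le]

/-- The function `s ^ (-a)`, damped by a logarithm at the origin. -/
noncomputable def logSingular (a s : ℝ) : ℝ := s ^ (-a) / Real.log (Real.exp 4 + s⁻¹)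

/-- The constant `exp 4` is chosen so that the logarithmic correction in `logSingularFactor` is at
most `1 / 4`, the value of `(d - 1) / 4` at `d = 2`; this makes `logSingular` decreasing. -/
lemma four_le_log_exp_add_inv {s : ℝ} (hs : 0 < s) : 4 ≤ Real.log (Real.exp 4 + s⁻¹) := by
  have h : 0 < s⁻¹ := inv_pos.2 hs
  rw [Real.le_log_iff_exp_le (by positivity)]
  linarith

lemma logSingular_pos (a : ℝ) {s : ℝ} (hs : 0 < s) : 0 < logSingular a s :=
  div_pos (Real.rpow_pos_of_pos hs _) (by linarith [four_le_log_exp_add_inv hs])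

/-- The factor `a - 1 / ((e⁴ s + 1) log (e⁴ + 1 / s))` in the derivative of `logSingular a`. -/
noncomputable def logSingularFactor (a s : ℝ) : ℝ :=
  a - 1 / ((Real.exp 4 * s + 1) * Real.log (Real.exp 4 + s⁻¹))

lemma logSingularFactor_nonneg {a s : ℝ} (ha : 1 / 4 ≤ a) (hs : 0 < s) :
    0 ≤ logSingularFactor a s := by
  have h4 := four_le_log_exp_add_inv hs
  have h1 : 1 ≤ Real.exp 4 * s + 1 := by have := Real.exp_pos 4; nlinarith
  have h : (4 : ℝ) ≤ (Real.exp 4 * s + 1) * Real.log (Real.exp 4 + s⁻¹) := by nlinarith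
  have := one_div_le_one_div_of_le (by norm_num) h
  unfold logSingularFactor
  linarith

lemma logSingularFactor_le (a : ℝ) {s : ℝ} (hs : 0 < s) : logSingularFactor a s ≤ a := by
  have h4 := four_le_log_exp_add_inv hs
  have : 0 ≤ 1 / ((Real.exp 4 * s + 1) * Real.log (Real.exp 4 + s⁻¹)) := by positivity
  unfold logSingularFactor
  linarith

lemma hasDerivAt_log_exp_add_inv {s : ℝ} (hs : 0 < s) :
    HasDerivAt (fun t => Real.log (Real.exp 4 + t⁻¹)) (-(s⁻¹ / (Real.exp 4 * s + 1))) s := by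
  have h0 : Real.exp 4 + s⁻¹ ≠ 0 := by positivity
  have h1 : Real.exp 4 * s + 1 ≠ 0 := by positivity
  have h := ((hasDerivAt_inv hs.ne').const_add (Real.exp 4)).log h0
  convert h using 1
  field_simp

lemma hasDerivAt_logSingular (a : ℝ) {s : ℝ} (hs : 0 < s) :
    HasDerivAt (logSingular a) (-(s⁻¹ * logSingular a s * logSingularFactor a s)) s := by
  have h4 := four_le_log_exp_add_inv hs
  have hL : Real.log (Real.exp 4 + s⁻¹) ≠ 0 := by linarith
  have h1 : Real.exp 4 * s + 1 ≠ 0 := by positivity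
  have h := (Real.hasDerivAt_rpow_const (p := -a) (Or.inl hs.ne')).div
    (hasDerivAt_log_exp_add_inv hs) hL
  refine h.congr_deriv ?_
  unfold logSingular logSingularFactor
  rw [Real.rpow_sub_one hs.ne']
  generalize Real.log (Real.exp 4 + s⁻¹) = L at hL ⊢
  field_simp
  ring

lemma antitoneOn_logSingular {a : ℝ} (ha : 1 / 4 ≤ a) : AntitoneOn (logSingular a) (Ioi 0) := by
  refine antitoneOn_of_deriv_nonpos (convex_Ioi 0)
    (fun s hs => (hasDerivAt_logSingular a hs).continuousAt.continuousWithinAt)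
    (fun s hs => ?_) fun s hs => ?_
  · rw [interior_Ioi] at hs
    exact (hasDerivAt_logSingular a hs).differentiableAt.differentiableWithinAt
  · rw [interior_Ioi] at hs
    rw [(hasDerivAt_logSingular a hs).deriv]
    have h1 := logSingular_pos a hs
    have h2 := logSingularFactor_nonneg ha hs
    have h3 : 0 < s⁻¹ := inv_pos.2 hs
    have : 0 ≤ s⁻¹ * logSingular a s * logSingularFactor a s := by positivity
    linarith

/-- `logSingular a` beats every power `s ^ (-b)` with `b < a`. -/
lemma exists_mul_rpow_le_logSingular {a b : ℝ} (hb : b < a) :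
    ∃ c > 0, ∀ s, 0 < s → s ≤ 1 → c * s ^ (-b) ≤ logSingular a s := by
  set r := a - b with hr
  have hr0 : 0 < r := by linarith
  refine ⟨r / (Real.exp 4 + 1) ^ r, by positivity, fun s hs hs1 => ?_⟩
  have h4 := four_le_log_exp_add_inv hs
  have hle : Real.log (Real.exp 4 + s⁻¹) ≤ (Real.exp 4 + 1) ^ r * s ^ (-r) / r := by
    have hi : 1 ≤ s⁻¹ := (one_le_inv₀ hs).2 hs1
    refine (Real.log_le_rpow_div (by positivity) hr0).trans ?_
    gcongr
    calc (Real.exp 4 + s⁻¹) ^ r ≤ ((Real.exp 4 + 1) * s⁻¹) ^ r := by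
          gcongr
          have := Real.exp_pos 4
          nlinarith
      _ = _ := by
          rw [Real.mul_rpow (by positivity) (by positivity), Real.inv_rpow hs.le,
            Real.rpow_neg hs.le]
  have hsa : s ^ (-a) = s ^ (-b) * s ^ (-r) := by
    rw [← Real.rpow_add hs]; congr 1; rw [hr]; ring
  have h5 : 0 < (Real.exp 4 + 1) ^ r := by positivity
  have h6 : 0 < s ^ (-b) := Real.rpow_pos_of_pos hs _
  have h7 : 0 < s ^ (-r) := Real.rpow_pos_of_pos hs _
  rw [logSingular, le_div_iff₀ (by linarith), hsa]
  calc r / (Real.exp 4 + 1) ^ r * s ^ (-b) * Real.log (Real.exp 4 + s⁻¹)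
      ≤ r / (Real.exp 4 + 1) ^ r * s ^ (-b) * ((Real.exp 4 + 1) ^ r * s ^ (-r) / r) := by gcongr
    _ = _ := by field_simp

/-- `r⁻¹ log(e⁴ + r⁻²)⁻²` is integrable near the origin. -/
lemma integrableOn_inv_mul_inv_log_sq :
    IntegrableOn (fun r : ℝ => r⁻¹ * (Real.log (Real.exp 4 + (r ^ 2)⁻¹) ^ 2)⁻¹) (Ioo 0 1) := by
  -- The inverse logarithm is continuous down to `0` and has nonnegative derivative `g'`, so `g'` is
  -- integrable; on `(0, 1)` the integrand is at most a constant times `g'`.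
  set g : ℝ → ℝ := fun r => if r ≤ 0 then 0 else (Real.log (Real.exp 4 + (r ^ 2)⁻¹))⁻¹
  set g' : ℝ → ℝ := fun r =>
    2 * (r * (Real.exp 4 * r ^ 2 + 1) * Real.log (Real.exp 4 + (r ^ 2)⁻¹) ^ 2)⁻¹
  have hd : ∀ r, 0 < r → HasDerivAt g (g' r) r := by
    intro r hr
    have h4 := four_le_log_exp_add_inv (pow_pos hr 2)
    have hL : Real.log (Real.exp 4 + (r ^ 2)⁻¹) ≠ 0 := by linarith
    have h1 : Real.exp 4 * r ^ 2 + 1 ≠ 0 := by positivity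
    have h := (HasDerivAt.comp (h := fun r : ℝ => r ^ 2) r
      (hasDerivAt_log_exp_add_inv (pow_pos hr 2)) (hasDerivAt_pow 2 r)).inv hL
    have h2 : HasDerivAt (fun r : ℝ => (Real.log (Real.exp 4 + (r ^ 2)⁻¹))⁻¹) (g' r) r := by
      refine h.congr_deriv ?_
      simp only [g', Function.comp_apply]
      generalize Real.log (Real.exp 4 + (r ^ 2)⁻¹) = L at hL ⊢
      field_simp
      norm_num
      ring
    refine h2.congr_of_eventuallyEq ?_
    filter_upwards [Ioi_mem_nhds hr] with t ht
    simp [g, not_le.2 (mem_Ioi.1 ht)]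
  have hg0 : ContinuousWithinAt g (Icc 0 1) 0 := by
    have hlog : Tendsto (fun r : ℝ => (Real.log (Real.exp 4 + (r ^ 2)⁻¹))⁻¹) (𝓝[>] 0) (𝓝 0) := by
      refine tendsto_inv_atTop_zero.comp (Real.tendsto_log_atTop.comp ?_)
      refine tendsto_atTop_add_const_left _ _ (tendsto_inv_nhdsGT_zero.comp ?_)
      refine tendsto_nhdsWithin_iff.2 ⟨?_, ?_⟩
      · have : Tendsto (fun r : ℝ => r ^ 2) (𝓝 0) (𝓝 (0 ^ 2)) := (continuous_pow 2).tendsto 0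
        rw [zero_pow (by norm_num)] at this
        exact this.mono_left nhdsWithin_le_nhds
      · filter_upwards [self_mem_nhdsWithin] with r hr
        exact pow_pos (mem_Ioi.1 hr) 2
    have h0 : g 0 = 0 := by simp [g]
    have h1 : ContinuousWithinAt g (Ioi 0) 0 := by
      rw [ContinuousWithinAt, h0]
      refine hlog.congr' ?_
      filter_upwards [self_mem_nhdsWithin] with r hr
      simp [g, not_le.2 (mem_Ioi.1 hr)]
    exact (continuousWithinAt_Ioi_iff_Ici.1 h1).mono Icc_subset_Ici_self
  have hint : IntegrableOn g' (Ioc 0 1) := by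
    refine intervalIntegral.integrableOn_deriv_of_nonneg (g := g) (fun r hr => ?_)
      (fun r hr => hd r hr.1) fun r hr => ?_
    · rcases hr.1.eq_or_lt with h | h
      · rw [← h]; exact hg0
      · exact (hd r h).continuousAt.continuousWithinAt
    · have := hr.1
      simp only [g']
      positivity
  refine ((hint.mono_set Ioo_subset_Ioc_self).const_mul ((Real.exp 4 + 1) / 2)).mono'
    (Measurable.aestronglyMeasurable (by fun_prop)) ?_
  filter_upwards [ae_restrict_mem measurableSet_Ioo] with r hr
  have hr0 := hr.1
  have h4 := four_le_log_exp_add_inv (pow_pos hr0 2)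
  rw [Real.norm_of_nonneg (by positivity)]
  simp only [g']
  have h1 : Real.exp 4 * r ^ 2 + 1 ≤ Real.exp 4 + 1 := by
    have : r ^ 2 ≤ 1 := pow_le_one₀ hr0.le hr.2.le
    have := Real.exp_pos 4
    nlinarith
  have h2 : 0 < Real.exp 4 * r ^ 2 + 1 := by positivity
  rw [mul_inv, mul_inv]
  have h3 : 1 ≤ (Real.exp 4 + 1) * (Real.exp 4 * r ^ 2 + 1)⁻¹ := by
    rwa [← div_eq_mul_inv, one_le_div h2]
  have h5 : 0 ≤ r⁻¹ * (Real.log (Real.exp 4 + (r ^ 2)⁻¹) ^ 2)⁻¹ := by positivity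
  calc r⁻¹ * (Real.log (Real.exp 4 + (r ^ 2)⁻¹) ^ 2)⁻¹
      ≤ (r⁻¹ * (Real.log (Real.exp 4 + (r ^ 2)⁻¹) ^ 2)⁻¹) *
        ((Real.exp 4 + 1) * (Real.exp 4 * r ^ 2 + 1)⁻¹) := le_mul_of_one_le_right h5 h3
    _ = _ := by ring

end LogSingular

/-! ### Weak gradients of singular radial functions. -/

section RadialWeakGradient

variable {E : Type*} [NormedAddCommGroup E] [InnerProductSpace ℝ E] [FiniteDimensional ℝ E]
  [MeasureSpace E] [BorelSpace E] [(volume : Measure E).IsAddHaarMeasure]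

lemma ContinuousOn.aestronglyMeasurable_of_compl_singleton [Nontrivial E] {F : Type*}
    [TopologicalSpace F] [TopologicalSpace.PseudoMetrizableSpace F] {f : E → F} {a : E}
    [SecondCountableTopologyEither E F] (hf : ContinuousOn f {a}ᶜ) :
    AEStronglyMeasurable f (volume : Measure E) := by
  have h := hf.aestronglyMeasurable (μ := (volume : Measure E)) (measurableSet_singleton a).compl
  rwa [restrict_compl_singleton] at h

omit [FiniteDimensional ℝ E] [MeasureSpace E] [BorelSpace E]
  [(volume : Measure E).IsAddHaarMeasure] in
lemma hasFDerivAt_radial_add {φ ψ : ℝ → ℝ} (hφ : ∀ s, 0 < s → HasDerivAt φ (-ψ s) s) {ε : ℝ}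
    (hε : 0 < ε) (y : E) :
    HasFDerivAt (fun y : E => φ (‖y‖ ^ 2 + ε)) (-ψ (‖y‖ ^ 2 + ε) • (2 • innerSL ℝ y : E →L[ℝ] ℝ))
      y :=
  (hφ (‖y‖ ^ 2 + ε) (by positivity)).comp_hasFDerivAt y
    ((hasStrictFDerivAt_norm_sq y).hasFDerivAt.add_const ε)

/-- A radial function `φ (‖y‖²)` which is differentiable away from the origin has its pointwise
gradient as weak gradient, provided `φ` and `φ'` are dominated by decreasing profiles that give
integrable functions. -/
theorem hasWeakGradientL1_radial [Nontrivial E] {φ ψ Φ Ψ : ℝ → ℝ}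
    (hφ : ∀ s, 0 < s → HasDerivAt φ (-ψ s) s) (hψc : ContinuousOn ψ (Ioi 0))
    (hφΦ : ∀ s, 0 < s → |φ s| ≤ Φ s) (hΦ : AntitoneOn Φ (Ioi 0))
    (hψΨ : ∀ s, 0 < s → |ψ s| ≤ Ψ s) (hΨ : AntitoneOn Ψ (Ioi 0))
    (hΦi : Integrable fun y : E => Φ (‖y‖ ^ 2))
    (hΨi : Integrable fun y : E => Ψ (‖y‖ ^ 2) * ‖y‖) :
    HasWeakGradientL1 (fun y : E => φ (‖y‖ ^ 2)) fun y => -(2 * ψ (‖y‖ ^ 2)) • y := by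
  have hφc : ContinuousOn φ (Ioi 0) := fun s hs => (hφ s hs).continuousAt.continuousWithinAt
  have hmaps : MapsTo (fun y : E => ‖y‖ ^ 2) {0}ᶜ (Ioi 0) := fun y hy =>
    pow_pos (norm_pos_iff.2 hy) 2
  have hnc : ContinuousOn (fun y : E => ‖y‖ ^ 2) {0}ᶜ := by fun_prop
  have hne : ∀ᵐ y : E, y ≠ 0 := by
    simpa using measure_eq_zero_iff_ae_notMem.1 (measure_singleton (μ := volume) (0 : E))
  have hui : Integrable fun y : E => φ (‖y‖ ^ 2) := by
    refine hΦi.mono' (hφc.comp hnc hmaps).aestronglyMeasurable_of_compl_singleton ?_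
    filter_upwards [hne] with y hy
    exact hφΦ _ (hmaps hy)
  have hgi : Integrable fun y : E => -(2 * ψ (‖y‖ ^ 2)) • y := by
    refine (hΨi.const_mul 2).mono' (ContinuousOn.aestronglyMeasurable_of_compl_singleton (a := 0)
      (((hψc.comp hnc hmaps).const_mul 2).neg.smul continuousOn_id)) ?_
    filter_upwards [hne] with y hy
    rw [norm_smul, norm_neg, norm_mul, Real.norm_ofNat, mul_assoc]
    gcongr
    exact hψΨ _ (hmaps hy)
  refine ⟨⟨hui.locallyIntegrable, hgi.locallyIntegrable, fun η hη hηc v => ?_⟩, hui, hgi⟩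
  -- Replacing `‖y‖ ^ 2` by `‖y‖ ^ 2 + ε k` removes the singularity and permits ordinary integration
  -- by parts. Since `Φ` and `Ψ` are decreasing, their unshifted values dominate for every `k`.
  set ε : ℕ → ℝ := fun k => 1 / ((k : ℝ) + 1)
  have hε : ∀ k, 0 < ε k := fun k => by positivity
  have hεlim : Tendsto ε atTop (𝓝 0) := tendsto_one_div_add_atTop_nhds_zero_nat
  have hη1 : Continuous (fderiv ℝ η) := hη.continuous_fderiv (by simp)
  have hηv : Continuous fun y => fderiv ℝ η y v := by fun_prop
  have hηvc : HasCompactSupport fun y => fderiv ℝ η y v :=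
    hηc.fderiv_apply (𝕜 := ℝ) v
  have hpos : ∀ k (y : E), 0 < ‖y‖ ^ 2 + ε k := fun k y => by have := hε k; positivity
  have hfd : ∀ k (y : E), fderiv ℝ (fun y : E => φ (‖y‖ ^ 2 + ε k)) y v =
      -(2 * ψ (‖y‖ ^ 2 + ε k)) * inner ℝ y v := by
    intro k y
    rw [(hasFDerivAt_radial_add hφ (hε k) y).fderiv]
    simp
    ring
  have hφk : ∀ k, Continuous fun y : E => φ (‖y‖ ^ 2 + ε k) := fun k =>
    hφc.comp_continuous (by fun_prop) (hpos k)
  have hψk : ∀ k, Continuous fun y : E => ψ (‖y‖ ^ 2 + ε k) := fun k =>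
    hψc.comp_continuous (by fun_prop) (hpos k)
  have hibp : ∀ k, ∫ y, φ (‖y‖ ^ 2 + ε k) * fderiv ℝ η y v =
      -∫ y, -(2 * ψ (‖y‖ ^ 2 + ε k)) * inner ℝ y v * η y := by
    intro k
    have hd : ∀ k (y : E), DifferentiableAt ℝ (fun y : E => φ (‖y‖ ^ 2 + ε k)) y := fun k y =>
      (hasFDerivAt_radial_add hφ (hε k) y).differentiableAt
    simp only [← hfd]
    refine integral_mul_fderiv_eq_neg_fderiv_mul_of_integrable ?_ ?_ ?_ (fun y _ => hd k y)
      fun y _ => (hη.differentiable (by simp)) y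
    · simp only [hfd]
      exact Continuous.integrable_of_hasCompactSupport
        ((((hψk k).const_mul 2).neg.mul (by fun_prop)).mul hη.continuous) hηc.mul_left
    · exact Continuous.integrable_of_hasCompactSupport ((hφk k).mul hηv) hηvc.mul_left
    · exact Continuous.integrable_of_hasCompactSupport ((hφk k).mul hη.continuous) hηc.mul_left
  obtain ⟨C, hC⟩ := hηv.bounded_above_of_compact_support hηvc
  obtain ⟨C', hC'⟩ := hη.continuous.bounded_above_of_compact_support hηc
  have hshift : ∀ y : E, Tendsto (fun k => ‖y‖ ^ 2 + ε k) atTop (𝓝 (‖y‖ ^ 2)) := fun y => by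
    simpa using hεlim.const_add (‖y‖ ^ 2)
  have hle : ∀ k (y : E), ‖y‖ ^ 2 ≤ ‖y‖ ^ 2 + ε k := fun k y => by linarith [hε k]
  have hL : Tendsto (fun k => ∫ y, φ (‖y‖ ^ 2 + ε k) * fderiv ℝ η y v) atTop
      (𝓝 (∫ y, φ (‖y‖ ^ 2) * fderiv ℝ η y v)) := by
    refine tendsto_integral_of_dominated_convergence (fun y => Φ (‖y‖ ^ 2) * C)
      (fun k => ((hφk k).mul hηv).aestronglyMeasurable) (hΦi.mul_const C) (fun k => ?_) ?_
    · filter_upwards [hne] with y hy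
      rw [norm_mul]
      have h1 : |φ (‖y‖ ^ 2 + ε k)| ≤ Φ (‖y‖ ^ 2) :=
        (hφΦ _ (hpos k y)).trans (hΦ (hmaps hy) (hpos k y) (hle k y))
      exact mul_le_mul h1 (hC y) (norm_nonneg _) ((abs_nonneg _).trans h1)
    · filter_upwards [hne] with y hy
      exact ((hφ _ (hmaps hy)).continuousAt.tendsto.comp (hshift y)).mul_const _
  have hR : Tendsto (fun k => ∫ y, -(2 * ψ (‖y‖ ^ 2 + ε k)) * inner ℝ y v * η y) atTop
      (𝓝 (∫ y, -(2 * ψ (‖y‖ ^ 2)) * inner ℝ y v * η y)) := by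
    refine tendsto_integral_of_dominated_convergence
      (fun y => 2 * (Ψ (‖y‖ ^ 2) * ‖y‖) * ‖v‖ * C')
      (fun k => ((((hψk k).const_mul 2).neg.mul (by fun_prop)).mul
        hη.continuous).aestronglyMeasurable)
      (((hΨi.const_mul 2).mul_const _).mul_const _) (fun k => ?_) ?_
    · filter_upwards [hne] with y hy
      rw [norm_mul, norm_mul, norm_neg, norm_mul, Real.norm_ofNat]
      have h1 : |ψ (‖y‖ ^ 2 + ε k)| ≤ Ψ (‖y‖ ^ 2) :=
        (hψΨ _ (hpos k y)).trans (hΨ (hmaps hy) (hpos k y) (hle k y))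
      have h0 : 0 ≤ Ψ (‖y‖ ^ 2) := (abs_nonneg _).trans h1
      have h2 : 2 * ‖ψ (‖y‖ ^ 2 + ε k)‖ * ‖(inner ℝ y v : ℝ)‖ ≤
          2 * (Ψ (‖y‖ ^ 2) * ‖y‖) * ‖v‖ := by
        calc 2 * ‖ψ (‖y‖ ^ 2 + ε k)‖ * ‖(inner ℝ y v : ℝ)‖
            ≤ 2 * Ψ (‖y‖ ^ 2) * (‖y‖ * ‖v‖) := by
              gcongr
              exacts [h1, norm_inner_le_norm y v]
          _ = _ := by ring
      exact mul_le_mul h2 (hC' y) (norm_nonneg _) (by positivity)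
    · filter_upwards [hne] with y hy
      have h1 : ContinuousAt ψ (‖y‖ ^ 2) := hψc.continuousAt (Ioi_mem_nhds (hmaps hy))
      exact (((h1.tendsto.comp (hshift y)).const_mul 2).neg.mul_const _).mul_const _
  refine (tendsto_nhds_unique hL ((hR.neg).congr fun k => (hibp k).symm)).trans ?_
  congr 1
  refine integral_congr_ae (Eventually.of_forall fun y => ?_)
  simp only [inner_smul_left, conj_trivial]
  ring

end RadialWeakGradient

/-! ### Decreasing mollifiers bounded below on `(0, 1]`. -/

section PowerMollifier

/-- The decreasing mollifiers `ε r ^ (ε - d)` on `(0, 1]`, with `ε = 1 / (n + 1)`. -/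
noncomputable def powerMollifier (d n : ℕ) (r : ℝ) : ℝ :=
  (Iic 1).indicator (fun r => 1 / ((n : ℝ) + 1) * r ^ (1 / ((n : ℝ) + 1) - d)) r

lemma powerMollifier_of_le {d n : ℕ} {r : ℝ} (hr : r ≤ 1) :
    powerMollifier d n r = 1 / ((n : ℝ) + 1) * r ^ (1 / ((n : ℝ) + 1) - d) :=
  indicator_of_mem (mem_Iic.2 hr) _

lemma powerMollifier_of_lt {d n : ℕ} {r : ℝ} (hr : 1 < r) : powerMollifier d n r = 0 :=
  indicator_of_notMem (notMem_Iic.2 hr) _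

lemma powerMollifier_nonneg (d n : ℕ) {r : ℝ} (hr : 0 < r) : 0 ≤ powerMollifier d n r :=
  indicator_apply_nonneg fun _ => by positivity

lemma powerMollifier_exponent_nonpos {d : ℕ} (hd : 1 ≤ d) (n : ℕ) :
    1 / ((n : ℝ) + 1) - d ≤ 0 := by
  have h1 : (1 : ℝ) ≤ d := by exact_mod_cast hd
  have h2 : 1 / ((n : ℝ) + 1) ≤ 1 := by
    rw [div_le_one (by positivity)]; linarith [n.cast_nonneg (α := ℝ)]
  linarith

lemma antitoneOn_powerMollifier {d : ℕ} (hd : 1 ≤ d) (n : ℕ) :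
    AntitoneOn (powerMollifier d n) (Ioi 0) := by
  intro r hr s hs hrs
  rcases le_or_gt s 1 with h | h
  · rw [powerMollifier_of_le h, powerMollifier_of_le (hrs.trans h)]
    exact mul_le_mul_of_nonneg_left
      (Real.rpow_le_rpow_of_nonpos hr hrs (powerMollifier_exponent_nonpos hd n)) (by positivity)
  · rw [powerMollifier_of_lt h]
    exact powerMollifier_nonneg d n hr

lemma le_powerMollifier {d : ℕ} (hd : 1 ≤ d) (n : ℕ) {r : ℝ} (hr : 0 < r) (hr1 : r ≤ 1) :
    1 / ((n : ℝ) + 1) ≤ powerMollifier d n r := by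
  rw [powerMollifier_of_le hr1]
  exact le_mul_of_one_le_right (by positivity)
    (Real.one_le_rpow_of_pos_of_le_one_of_nonpos hr hr1 (powerMollifier_exponent_nonpos hd n))

lemma integral_Ioi_powerMollifier {d : ℕ} (hd : 1 ≤ d) (n : ℕ) {δ : ℝ} (hδ : 0 ≤ δ)
    (hδ1 : δ ≤ 1) :
    ∫ r in Ioi δ, powerMollifier d n r * r ^ (d - 1) = 1 - δ ^ (1 / ((n : ℝ) + 1)) := by
  have hε : (0 : ℝ) < 1 / ((n : ℝ) + 1) := by positivity
  have h : ∫ r in Ioi δ, powerMollifier d n r * r ^ (d - 1) =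
      ∫ r in Ioi δ, (Iic (1 : ℝ)).indicator
        (fun r => 1 / ((n : ℝ) + 1) * r ^ (1 / ((n : ℝ) + 1) - 1)) r := by
    refine setIntegral_congr_fun measurableSet_Ioi fun r hr => ?_
    have hr0 : 0 < r := hδ.trans_lt hr
    rcases le_or_gt r 1 with h | h
    · simp only [powerMollifier_of_le h, indicator_of_mem (mem_Iic.2 h)]
      rw [mul_assoc, ← Real.rpow_natCast, ← Real.rpow_add hr0, Nat.cast_sub hd]
      congr 2
      push_cast
      ring
    · simp only [powerMollifier_of_lt h, indicator_of_notMem (notMem_Iic.2 h), zero_mul]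
  rw [h, setIntegral_indicator measurableSet_Iic, Ioi_inter_Iic,
    ← intervalIntegral.integral_of_le hδ1, intervalIntegral.integral_const_mul,
    integral_rpow (Or.inl (by linarith)), sub_add_cancel, Real.one_rpow]
  field_simp

theorem isRadialMollifier_powerMollifier {d : ℕ} (hd : 1 ≤ d) :
    IsRadialMollifier d (powerMollifier d) where
  locallyIntegrableOn n := by
    have hc : ContinuousOn
        (fun r : ℝ => 1 / ((n : ℝ) + 1) * r ^ (1 / ((n : ℝ) + 1) - d)) (Ioi 0) :=
      continuousOn_const.mul fun r hr =>
        (Real.continuousAt_rpow_const _ _ (Or.inl (ne_of_gt hr))).continuousWithinAt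
    refine (hc.locallyIntegrableOn (μ := volume) measurableSet_Ioi).mono
      (Measurable.indicator (by fun_prop) measurableSet_Iic).aestronglyMeasurable ?_
    filter_upwards with r
    exact norm_indicator_le_norm_self _ _
  nonneg n r hr := powerMollifier_nonneg d n hr
  integral_eq_one n := by
    rw [integral_Ioi_powerMollifier hd n le_rfl zero_le_one, Real.zero_rpow (by positivity),
      sub_zero]
  tendsto_zero δ hδ := by
    rcases le_or_gt δ 1 with h | h
    · simp only [integral_Ioi_powerMollifier hd _ hδ.le h]
      have h1 : Tendsto (fun n : ℕ => δ ^ (1 / ((n : ℝ) + 1))) atTop (𝓝 (δ ^ (0 : ℝ))) :=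
        tendsto_const_nhds.rpow tendsto_one_div_add_atTop_nhds_zero_nat (Or.inl hδ.ne')
      simpa using h1.const_sub 1
    · refine tendsto_const_nhds.congr fun n => ?_
      rw [← integral_zero ℝ ℝ (μ := volume.restrict (Ioi δ))]
      refine setIntegral_congr_fun measurableSet_Ioi fun r hr => ?_
      simp [powerMollifier_of_lt (h.trans hr)]
  eq_zero n r hr := powerMollifier_of_lt hr

end PowerMollifier

/-! ### The compactly supported singular profile. -/

section CutoffProfile

/-- A profile on `(0, ∞)` that is singular at the origin and vanishes on `[1, ∞)`. -/
noncomputable def logProfile (a s : ℝ) : ℝ := max (logSingular a s - logSingular a 1) 0 ^ 2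

/-- Minus the derivative of `logProfile a`. -/
noncomputable def logProfileDeriv (a s : ℝ) : ℝ :=
  2 * max (logSingular a s - logSingular a 1) 0 * (s⁻¹ * logSingular a s * logSingularFactor a s)

lemma hasDerivAt_logProfile (a : ℝ) {s : ℝ} (hs : 0 < s) :
    HasDerivAt (logProfile a) (-logProfileDeriv a s) s := by
  have h := (hasDerivAt_max_zero_sq (logSingular a s - logSingular a 1)).comp s
    ((hasDerivAt_logSingular a hs).sub_const (logSingular a 1))
  refine h.congr_deriv ?_
  unfold logProfileDeriv
  ring

lemma continuousOn_logProfileDeriv (a : ℝ) : ContinuousOn (logProfileDeriv a) (Ioi 0) := by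
  have hf : ContinuousOn (logSingular a) (Ioi 0) := fun s hs =>
    (hasDerivAt_logSingular a hs).continuousAt.continuousWithinAt
  have hi : ContinuousOn (fun s : ℝ => s⁻¹) (Ioi 0) := fun s hs =>
    (continuousAt_inv₀ (ne_of_gt hs)).continuousWithinAt
  have hL : ContinuousOn (fun s : ℝ => Real.log (Real.exp 4 + s⁻¹)) (Ioi 0) := fun s hs =>
    (hasDerivAt_log_exp_add_inv hs).continuousAt.continuousWithinAt
  have hF : ContinuousOn (logSingularFactor a) (Ioi 0) := by
    refine continuousOn_const.sub (continuousOn_const.div (ContinuousOn.mul (by fun_prop) hL) ?_)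
    intro s hs
    have h4 := four_le_log_exp_add_inv hs
    have h0 : 0 < Real.exp 4 * s + 1 := by have := mem_Ioi.1 hs; positivity
    exact mul_ne_zero h0.ne' (by linarith)
  exact (continuousOn_const.mul ((hf.sub continuousOn_const).sup continuousOn_const)).mul
    ((hi.mul hf).mul hF)

lemma max_logSingular_sub_eq_zero {a : ℝ} (ha : 1 / 4 ≤ a) {s : ℝ} (hs : 1 ≤ s) :
    max (logSingular a s - logSingular a 1) 0 = 0 :=
  max_eq_right (sub_nonpos.2 (antitoneOn_logSingular ha (mem_Ioi.2 one_pos)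
    (mem_Ioi.2 (by linarith)) hs))

lemma max_logSingular_sub_le (a : ℝ) {s : ℝ} (hs : 0 < s) :
    max (logSingular a s - logSingular a 1) 0 ≤ logSingular a s :=
  max_le (by linarith [logSingular_pos a one_pos]) (logSingular_pos a hs).le

lemma abs_logProfile_le {a : ℝ} (ha : 1 / 4 ≤ a) {s : ℝ} (hs : 0 < s) :
    |logProfile a s| ≤ (Iio 1).indicator (fun s => logSingular a s ^ 2) s := by
  rcases lt_or_ge s 1 with h | h
  · rw [indicator_of_mem (mem_Iio.2 h), logProfile, abs_of_nonneg (sq_nonneg _)]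
    exact pow_le_pow_left₀ (le_max_right _ _) (max_logSingular_sub_le a hs) 2
  · rw [logProfile, max_logSingular_sub_eq_zero ha h]
    simp [h]

lemma abs_logProfileDeriv_le {a : ℝ} (ha : 1 / 4 ≤ a) {s : ℝ} (hs : 0 < s) :
    |logProfileDeriv a s| ≤ 2 * a * (Iio 1).indicator (fun s => s⁻¹ * logSingular a s ^ 2) s := by
  rcases lt_or_ge s 1 with h | h
  · have h1 := logSingular_pos a hs
    have h2 := logSingularFactor_nonneg ha hs
    have h3 : 0 ≤ max (logSingular a s - logSingular a 1) 0 := le_max_right _ _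
    rw [indicator_of_mem (mem_Iio.2 h), logProfileDeriv, abs_of_nonneg (by positivity)]
    calc 2 * max (logSingular a s - logSingular a 1) 0 *
          (s⁻¹ * logSingular a s * logSingularFactor a s)
        ≤ 2 * logSingular a s * (s⁻¹ * logSingular a s * a) := by
          gcongr
          · exact max_logSingular_sub_le a hs
          · exact logSingularFactor_le a hs
      _ = _ := by ring
  · rw [logProfileDeriv, max_logSingular_sub_eq_zero ha h]
    simp [h]

lemma AntitoneOn.indicator_Iio {f : ℝ → ℝ} {t b : ℝ} (hf : AntitoneOn f (Ioi t))
    (h0 : ∀ s, t < s → 0 ≤ f s) : AntitoneOn ((Iio b).indicator f) (Ioi t) := by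
  intro r hr s hs hrs
  rcases lt_or_ge s b with h | h
  · rw [indicator_of_mem (mem_Iio.2 h), indicator_of_mem (mem_Iio.2 (hrs.trans_lt h))]
    exact hf hr hs hrs
  · rw [indicator_of_notMem (notMem_Iio.2 h)]
    exact indicator_apply_nonneg fun _ => h0 r hr

/-- The profile is of order `s ^ (-2 a)` up to logarithms, which leaves room below `2 a`. The
constant `M` will be the value of the function at the point where the energy is computed. -/
lemma eventually_rpow_le_logProfile_sub {a b : ℝ} (hb0 : 0 ≤ b) (hb : b < 2 * a) (M : ℝ) :
    ∀ᶠ s in 𝓝[>] (0 : ℝ), s ^ (-b) ≤ logProfile a s - M := by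
  obtain ⟨b', hb1, hb2⟩ := exists_between (show b / 2 < a by linarith)
  obtain ⟨c, hc, hcs⟩ := exists_mul_rpow_le_logSingular hb2
  have hf1 := logSingular_pos a one_pos
  have hlim : Tendsto (fun s : ℝ => c * s ^ (-(b' - b / 2))) (𝓝[>] 0) atTop :=
    (tendsto_rpow_neg_nhdsGT_zero (by linarith)).const_mul_atTop hc
  filter_upwards [hlim.eventually_ge_atTop (logSingular a 1 + |M| + 2),
    Ioo_mem_nhdsGT (zero_lt_one' ℝ)] with s hs hs1
  have hs0 := hs1.1
  have h1 := hcs s hs0 hs1.2.le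
  have ht : 1 ≤ s ^ (-(b / 2)) :=
    Real.one_le_rpow_of_pos_of_le_one_of_nonpos hs0 hs1.2.le (by linarith)
  have hsplit : s ^ (-b') = s ^ (-(b / 2)) * s ^ (-(b' - b / 2)) := by
    rw [← Real.rpow_add hs0]; congr 1; ring
  have hsq : s ^ (-b) = (s ^ (-(b / 2))) ^ 2 := by
    rw [sq, ← Real.rpow_add hs0]; congr 1; ring
  set t := s ^ (-(b / 2))
  have hM := abs_nonneg M
  -- The margin `|M| + 1` is chosen so that squaring gives at least `t ^ 2 + M`.
  have h2 : t + (|M| + 1) ≤ max (logSingular a s - logSingular a 1) 0 := by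
    refine le_max_of_le_left ?_
    have : t * (logSingular a 1 + |M| + 2) ≤ logSingular a s := by
      refine le_trans ?_ h1
      rw [hsplit, mul_left_comm]
      gcongr
    nlinarith
  have h3 : (t + (|M| + 1)) ^ 2 ≤ logProfile a s := pow_le_pow_left₀ (by linarith) h2 2
  rw [hsq]
  nlinarith [le_abs_self M]

end CutoffProfile

/-! ### Integrable gradient but infinite energy. -/

section Pathology

open Metric Module

variable {E : Type*} [NormedAddCommGroup E] [InnerProductSpace ℝ E] [FiniteDimensional ℝ E]
  [MeasureSpace E] [BorelSpace E] [(volume : Measure E).IsAddHaarMeasure]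

/-- The exponent `a = (d - 1) / 4` is the critical one: `(r ^ 2) ^ (-2 a)` cancels the Jacobian `r ^
(d - 1)`, leaving `r⁻¹ / log²`, integrable only thanks to the logarithm. -/
lemma integrable_indicator_logSingular (hd : 2 ≤ finrank ℝ E) :
    Integrable fun y : E => (Iio 1).indicator
      (fun s => s⁻¹ * logSingular (((finrank ℝ E : ℝ) - 1) / 4) s ^ 2) (‖y‖ ^ 2) * ‖y‖ := by
  have : Nontrivial E := Module.nontrivial_of_finrank_pos (R := ℝ) (by omega)
  set a : ℝ := ((finrank ℝ E : ℝ) - 1) / 4 with ha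
  have h : IntegrableOn (fun y : E => (fun r : ℝ => (r ^ 2)⁻¹ * logSingular a (r ^ 2) ^ 2 * r) ‖y‖)
      (ball 0 1) := by
    refine (integrableOn_fun_norm_addHaar (μ := (volume : Measure E))
      (f := fun r : ℝ => (r ^ 2)⁻¹ * logSingular a (r ^ 2) ^ 2 * r)).2 ?_
    refine integrableOn_inv_mul_inv_log_sq.congr_fun (fun r hr => ?_) measurableSet_Ioo
    have hr0 := hr.1
    have hpow : ((r ^ 2) ^ (-a)) ^ 2 * r ^ (finrank ℝ E - 1) = 1 := by
      rw [← Real.rpow_natCast r 2, ← Real.rpow_mul hr0.le, sq, ← Real.rpow_add hr0,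
        ← Real.rpow_natCast, ← Real.rpow_add hr0, Nat.cast_sub (by omega), ha]
      convert Real.rpow_zero r using 2
      push_cast
      ring
    simp only [logSingular, smul_eq_mul, div_pow]
    symm
    calc r ^ (finrank ℝ E - 1) * ((r ^ 2)⁻¹ *
          (((r ^ 2) ^ (-a)) ^ 2 / Real.log (Real.exp 4 + (r ^ 2)⁻¹) ^ 2) * r)
        = (((r ^ 2) ^ (-a)) ^ 2 * r ^ (finrank ℝ E - 1)) * ((r ^ 2)⁻¹ * r) *
          (Real.log (Real.exp 4 + (r ^ 2)⁻¹) ^ 2)⁻¹ := by ring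
      _ = _ := by
        rw [hpow, one_mul]
        congr 1
        field_simp
  refine (h.integrable_indicator measurableSet_ball).congr (Eventually.of_forall fun y => ?_)
  have hiff : ‖y‖ ^ 2 < 1 ↔ ‖y‖ < 1 := by
    rw [sq_lt_one_iff₀ (norm_nonneg y)]
  by_cases hy : ‖y‖ < 1
  · simp [indicator, hy]
  · simp [indicator, hy]

theorem hasWeakGradientL1_logProfile (hd : 2 ≤ finrank ℝ E) :
    HasWeakGradientL1 (fun y : E => logProfile (((finrank ℝ E : ℝ) - 1) / 4) (‖y‖ ^ 2))
      fun y => -(2 * logProfileDeriv (((finrank ℝ E : ℝ) - 1) / 4) (‖y‖ ^ 2)) • y := by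
  have : Nontrivial E := Module.nontrivial_of_finrank_pos (R := ℝ) (by omega)
  have hint := integrable_indicator_logSingular hd
  have ha : (1 : ℝ) / 4 ≤ ((finrank ℝ E : ℝ) - 1) / 4 := by
    have : (2 : ℝ) ≤ finrank ℝ E := by exact_mod_cast hd
    linarith
  set a : ℝ := ((finrank ℝ E : ℝ) - 1) / 4
  have hsq : AntitoneOn (fun s => logSingular a s ^ 2) (Ioi 0) := fun r hr s hs hrs =>
    pow_le_pow_left₀ (logSingular_pos a hs).le (antitoneOn_logSingular ha hr hs hrs) 2
  have hinv : AntitoneOn (fun s => s⁻¹ * logSingular a s ^ 2) (Ioi 0) := fun r hr s hs hrs =>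
    mul_le_mul (inv_anti₀ hr hrs) (hsq hr hs hrs) (sq_nonneg _) (inv_pos.2 hr).le
  have h0 : ∀ s, (0 : ℝ) < s → 0 ≤ s⁻¹ * logSingular a s ^ 2 := fun s hs => by positivity
  refine hasWeakGradientL1_radial (Φ := (Iio 1).indicator fun s => logSingular a s ^ 2)
    (Ψ := fun s => 2 * a * (Iio 1).indicator (fun s => s⁻¹ * logSingular a s ^ 2) s)
    (fun s hs => hasDerivAt_logProfile a hs) (continuousOn_logProfileDeriv a)
    (fun s hs => abs_logProfile_le ha hs) (hsq.indicator_Iio fun s _ => sq_nonneg _)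
    (fun s hs => abs_logProfileDeriv_le ha hs)
    (fun r hr s hs hrs => mul_le_mul_of_nonneg_left
      (hinv.indicator_Iio h0 hr hs hrs) (by linarith)) ?_ ?_
  · have hm : AEStronglyMeasurable
        (fun y : E => (Iio 1).indicator (fun s => logSingular a s ^ 2) (‖y‖ ^ 2)) := by
      refine Measurable.aestronglyMeasurable ?_
      have : Measurable ((Iio 1).indicator fun s => logSingular a s ^ 2) := by
        unfold logSingular
        exact Measurable.indicator (by fun_prop) measurableSet_Iio
      exact this.comp (by fun_prop)
    refine hint.mono' hm ?_
    have hne : ∀ᵐ y : E, y ≠ 0 := by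
      simpa using measure_eq_zero_iff_ae_notMem.1 (measure_singleton (μ := volume) (0 : E))
    filter_upwards [hne] with y hy
    have hy0 : 0 < ‖y‖ := norm_pos_iff.2 hy
    by_cases h : ‖y‖ ^ 2 < 1
    · rw [indicator_of_mem (mem_Iio.2 h), indicator_of_mem (mem_Iio.2 h), Real.norm_of_nonneg (sq_nonneg _)]
      have h1 : ‖y‖ < 1 := (sq_lt_one_iff₀ hy0.le).1 h
      -- Inside the unit ball the bound for the gradient is `‖y‖⁻¹` times that for the function, so
      -- its integrability suffices for both.
      have h2 : 1 ≤ (‖y‖ ^ 2)⁻¹ * ‖y‖ := by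
        rw [sq, mul_inv, mul_assoc, inv_mul_cancel₀ hy0.ne', mul_one]
        exact (one_le_inv₀ hy0).2 h1.le
      rw [mul_right_comm]
      exact le_mul_of_one_le_left (sq_nonneg _) h2
    · simp [indicator, h]
  · simpa only [mul_assoc] using hint.const_mul (2 * a)

lemma setLIntegral_ball_norm_rpow_neg_finrank [Nontrivial E] {δ : ℝ} (hδ : 0 < δ) :
    ∫⁻ y in ball (0 : E) δ, ENNReal.ofReal (‖y‖ ^ (-(finrank ℝ E : ℝ))) = ⊤ := by
  by_contra h
  have h1 := (lintegral_ofReal_ne_top_iff_integrable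
    (f := fun y : E => ‖y‖ ^ (-(finrank ℝ E : ℝ)))
    (Measurable.aestronglyMeasurable (by fun_prop))
    (Eventually.of_forall fun y => by positivity)).1 h
  have h2 := (integrableOn_fun_norm_addHaar (μ := (volume : Measure E))
    (f := fun r : ℝ => r ^ (-(finrank ℝ E : ℝ)))).1 h1
  have h3 : IntegrableOn (fun r : ℝ => r ^ (-1 : ℝ)) (Ioo 0 δ) := by
    refine h2.congr_fun (fun r hr => ?_) measurableSet_Ioo
    have hd : 1 ≤ finrank ℝ E := finrank_pos
    simp only [smul_eq_mul]
    rw [← Real.rpow_natCast, ← Real.rpow_add hr.1, Nat.cast_sub hd]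
    congr 1
    push_cast
    ring
  rw [intervalIntegral.integrableOn_Ioo_rpow_iff hδ] at h3
  exact lt_irrefl _ h3

/-- A singularity of order at least `d / p` makes the energy infinite at nearby points. -/
theorem nonlocalEnergy_eq_top [Nontrivial E] {u : E → ℝ} {x : E} {ρ : ℝ → ℝ} {p ε : ℝ}
    (hp : 0 < p) (hε : 0 < ε) (hρ : ∀ r, 0 < r → r ≤ 1 → ε ≤ ρ r) (hx : ‖x‖ < 1 / 2)
    (hu : ∀ᶠ y in 𝓝[≠] (0 : E), ‖y‖ ^ (-((finrank ℝ E : ℝ) / p)) ≤ |u x - u y|) :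
    nonlocalEnergy ρ p u x = ⊤ := by
  obtain ⟨δ', hδ', hball⟩ := Metric.mem_nhdsWithin_iff.1 hu
  -- With `‖x‖ < 1 / 2` and `‖y‖ < 1 / 2`, `‖x - y‖ ≤ 1`: dividing by `‖x - y‖ ^ p` only helps, and
  -- `ρ ≥ ε` applies.
  set δ := min δ' (1 / 2)
  have hδ : 0 < δ := lt_min hδ' (by norm_num)
  rw [← top_le_iff, nonlocalEnergy]
  calc (⊤ : ℝ≥0∞)
      = ENNReal.ofReal ε * ∫⁻ y in ball (0 : E) δ, ENNReal.ofReal (‖y‖ ^ (-(finrank ℝ E : ℝ))) := by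
        rw [setLIntegral_ball_norm_rpow_neg_finrank hδ, ENNReal.mul_top (by simpa using hε)]
    _ = ∫⁻ y in ball (0 : E) δ, ENNReal.ofReal ε * ENNReal.ofReal (‖y‖ ^ (-(finrank ℝ E : ℝ))) :=
        (lintegral_const_mul' _ _ ENNReal.ofReal_ne_top).symm
    _ ≤ ∫⁻ y in ball (0 : E) δ,
          ENNReal.ofReal (|u x - u y| ^ p / ‖x - y‖ ^ p * ρ ‖x - y‖) := by
        refine lintegral_mono_ae ?_
        have hne : ∀ z : E, ∀ᵐ y : E, y ≠ z := fun z => by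
          simpa using measure_eq_zero_iff_ae_notMem.1 (measure_singleton (μ := volume) z)
        filter_upwards [ae_restrict_mem measurableSet_ball, ae_restrict_of_ae (hne 0),
          ae_restrict_of_ae (hne x)] with y hy hy0 hyx
        rw [mem_ball_zero_iff] at hy
        rw [← ENNReal.ofReal_mul hε.le]
        refine ENNReal.ofReal_le_ofReal ?_
        have h1 : 0 < ‖x - y‖ := norm_pos_iff.2 (sub_ne_zero.2 hyx.symm)
        have h2 : ‖x - y‖ ≤ 1 := by
          have := norm_sub_le x y
          have := hy.trans_le (min_le_right _ _)
          linarith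
        have h3 : ‖y‖ ^ (-((finrank ℝ E : ℝ) / p)) ≤ |u x - u y| :=
          hball ⟨by simpa using hy.trans_le (min_le_left _ _), hy0⟩
        have h4 : ‖y‖ ^ (-(finrank ℝ E : ℝ)) ≤ |u x - u y| ^ p := by
          have := Real.rpow_le_rpow (by positivity) h3 hp.le
          rwa [← Real.rpow_mul (norm_nonneg y), neg_mul, div_mul_cancel₀ _ hp.ne'] at this
        have h5 : |u x - u y| ^ p ≤ |u x - u y| ^ p / ‖x - y‖ ^ p := by
          refine le_div_self (by positivity) (by positivity) ?_
          exact Real.rpow_le_one h1.le h2 hp.le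
        rw [mul_comm ε]
        exact mul_le_mul (h4.trans h5) (hρ _ h1 h2) hε.le (by positivity)
    _ ≤ _ := setLIntegral_le_lintegral _ _

theorem nonlocalEnergy_logProfile_eq_top (hd : 2 ≤ finrank ℝ E) (n : ℕ) {x : E}
    (hx : ‖x‖ < 1 / 2) {p : ℝ} (hp : (finrank ℝ E : ℝ) / ((finrank ℝ E : ℝ) - 1) < p) :
    nonlocalEnergy (powerMollifier (finrank ℝ E) n) p
      (fun y : E => logProfile (((finrank ℝ E : ℝ) - 1) / 4) (‖y‖ ^ 2)) x = ⊤ := by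
  have : Nontrivial E := Module.nontrivial_of_finrank_pos (R := ℝ) (by omega)
  have hd2 : (2 : ℝ) ≤ finrank ℝ E := by exact_mod_cast hd
  have hp0 : 0 < p := lt_of_le_of_lt (div_nonneg (by linarith) (by linarith)) hp
  refine nonlocalEnergy_eq_top (ε := 1 / ((n : ℝ) + 1)) hp0 (by positivity)
    (fun r hr hr1 => le_powerMollifier (by omega) n hr hr1) hx ?_
  -- In the variable `s = ‖y‖ ^ 2` the required singularity `‖y‖ ^ (-d / p)` is `s ^ (-d / (2 p))`,
  -- and `d / (2 p) < (d - 1) / 2` means `p > d / (d - 1)`.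
  have hb : (finrank ℝ E : ℝ) / (2 * p) < 2 * (((finrank ℝ E : ℝ) - 1) / 4) := by
    rw [div_lt_iff₀ (by linarith)] at hp
    rw [div_lt_iff₀ (by linarith)]
    nlinarith
  have hlim : Tendsto (fun y : E => ‖y‖ ^ 2) (𝓝[≠] 0) (𝓝[>] 0) := by
    refine tendsto_nhdsWithin_iff.2 ⟨?_, ?_⟩
    · have : Tendsto (fun y : E => ‖y‖ ^ 2) (𝓝 0) (𝓝 (‖(0 : E)‖ ^ 2)) :=
        (continuous_norm.pow 2).tendsto 0
      rw [norm_zero, zero_pow (by norm_num)] at this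
      exact this.mono_left nhdsWithin_le_nhds
    · filter_upwards [self_mem_nhdsWithin] with y hy
      exact pow_pos (norm_pos_iff.2 hy) 2
  filter_upwards [hlim.eventually (eventually_rpow_le_logProfile_sub (by positivity) hb
    (logProfile (((finrank ℝ E : ℝ) - 1) / 4) (‖x‖ ^ 2)))] with y hy
  rw [abs_sub_comm]
  refine le_trans (le_of_eq ?_) (hy.trans (le_abs_self _))
  rw [← Real.rpow_natCast ‖y‖ 2, ← Real.rpow_mul (norm_nonneg y)]
  congr 1
  push_cast
  field_simp

end Pathology

/-! ### Assembly of the four statements. -/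

theorem mainTheorem4 :
    -- (1) dimension one
    (∀ ρ : ℕ → ℝ → ℝ, IsRadialMollifier 1 ρ →
      ∀ u u' : ℝ → ℝ, HasWeakGradientLoc u u' →
      ∀ p : ℝ, 1 < p → ∀ e : ℝ, ‖e‖ = 1 →
      ∀ᵐ x : ℝ, Tendsto (fun n => nonlocalEnergy (ρ n) p u x) atTop
        (𝓝 (ENNReal.ofReal (sphereMoment p e * |u' x| ^ p)))) ∧
    -- (2) non-increasing mollifiers, p at most d / (d - 1)
    (∀ d : ℕ, 2 ≤ d → ∀ ρ : ℕ → ℝ → ℝ, IsRadialMollifier d ρ →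
      (∀ n, AntitoneOn (ρ n) (Ioi 0)) →
      ∀ (u : EuclideanSpace ℝ (Fin d) → ℝ)
        (g : EuclideanSpace ℝ (Fin d) → EuclideanSpace ℝ (Fin d)), HasWeakGradientLoc u g →
      ∀ p : ℝ, 1 ≤ p → p ≤ (d : ℝ) / ((d : ℝ) - 1) →
      ∀ e : EuclideanSpace ℝ (Fin d), ‖e‖ = 1 →
      ∀ᵐ x : EuclideanSpace ℝ (Fin d), Tendsto (fun n => nonlocalEnergy (ρ n) p u x) atTop
        (𝓝 (ENNReal.ofReal (sphereMoment p e * ‖g x‖ ^ p)))) ∧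
    -- (3) the lower bound
    (∀ d : ℕ, 2 ≤ d → ∀ ρ : ℕ → ℝ → ℝ, IsRadialMollifier d ρ →
      ∀ (u : EuclideanSpace ℝ (Fin d) → ℝ)
        (g : EuclideanSpace ℝ (Fin d) → EuclideanSpace ℝ (Fin d)), HasWeakGradientLoc u g →
      ∀ p : ℝ, 1 < p → ∀ e : EuclideanSpace ℝ (Fin d), ‖e‖ = 1 →
      ∀ᵐ x : EuclideanSpace ℝ (Fin d),
        ENNReal.ofReal (sphereMoment p e * ‖g x‖ ^ p) ≤
          liminf (fun n => nonlocalEnergy (ρ n) p u x) atTop) ∧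
    -- (4) the pathology above the exponent d / (d - 1)
    (∀ d : ℕ, 2 ≤ d →
      ∃ (u : EuclideanSpace ℝ (Fin d) → ℝ)
        (g : EuclideanSpace ℝ (Fin d) → EuclideanSpace ℝ (Fin d))
        (A : Set (EuclideanSpace ℝ (Fin d))) (ρ : ℕ → ℝ → ℝ),
        HasWeakGradientL1 u g ∧ HasCompactSupport u ∧
        MeasurableSet A ∧ 0 < volume A ∧
        IsRadialMollifier d ρ ∧ (∀ n, AntitoneOn (ρ n) (Ioi 0)) ∧
        ∀ n, ∀ᵐ x : EuclideanSpace ℝ (Fin d), x ∈ A →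
          ∀ p : ℝ, (d : ℝ) / ((d : ℝ) - 1) < p → nonlocalEnergy (ρ n) p u x = ⊤) := by
  refine ⟨fun ρ hρ u u' h p hp e he => h.ae_tendsto_nonlocalEnergy_real hρ hp he, ?_, ?_, ?_⟩
  · intro d hd ρ hρ ha u g h p hp hpd e he
    have hf : Module.finrank ℝ (EuclideanSpace ℝ (Fin d)) = d := finrank_euclideanSpace_fin
    have : Nontrivial (EuclideanSpace ℝ (Fin d)) :=
      Module.nontrivial_of_finrank_pos (R := ℝ) (by omega)
    exact h.ae_tendsto_nonlocalEnergy_of_antitoneOn (by rwa [hf]) ha (by rwa [hf]) hp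
      (by rwa [hf]) he
  · intro d hd ρ hρ u g h p hp e he
    have hf : Module.finrank ℝ (EuclideanSpace ℝ (Fin d)) = d := finrank_euclideanSpace_fin
    have : Nontrivial (EuclideanSpace ℝ (Fin d)) :=
      Module.nontrivial_of_finrank_pos (R := ℝ) (by omega)
    exact h.ae_le_liminf_nonlocalEnergy (by rwa [hf]) hp.le he
  · intro d hd
    have hf : Module.finrank ℝ (EuclideanSpace ℝ (Fin d)) = d := finrank_euclideanSpace_fin
    have hd' : 2 ≤ Module.finrank ℝ (EuclideanSpace ℝ (Fin d)) := by rwa [hf]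
    have hdR : (2 : ℝ) ≤ d := by exact_mod_cast hd
    have hW := hasWeakGradientL1_logProfile hd'
    have hE := fun (n : ℕ) (x : EuclideanSpace ℝ (Fin d)) (hx : ‖x‖ < 1 / 2) (p : ℝ) =>
      nonlocalEnergy_logProfile_eq_top hd' n hx (p := p)
    rw [hf] at hW
    simp only [hf] at hE
    refine ⟨_, _, Metric.ball 0 (1 / 2), powerMollifier d, hW, ?_, measurableSet_ball,
      Metric.measure_ball_pos _ _ (by norm_num), isRadialMollifier_powerMollifier (by omega),
      antitoneOn_powerMollifier (by omega), fun n => Eventually.of_forall fun x hx p hp =>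
        hE n x (mem_ball_zero_iff.1 hx) p hp⟩
    refine HasCompactSupport.intro (isCompact_closedBall 0 1) fun y hy => ?_
    have hy1 : 1 ≤ ‖y‖ ^ 2 := one_le_pow₀ (by simpa using (not_le.1 (by simpa using hy)).le)
    rw [logProfile, max_logSingular_sub_eq_zero (by linarith) hy1, zero_pow two_ne_zero]
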